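/- **Corollary 2.** Let $p\ge 0$, and let $P_k$ denote the Legendre polynomials on $[-1,1]$ with $P_k(1)=1$. Put $R=P_{p+1}-P_p$, $$f(z,\xi)=\frac{(-1)^{p+1}}{2}\sum_{k=1}^{p+1}2^k z^{p+1-k}R^{(k)}(\xi),\qquad g(z)=z^{p+1}+f(z,-1).$$ Call the non-zero roots of the polynomial $g(z)-f(z,1)$ the *non-physical roots*. Then every non-physical root has positive real part. Moreover, let $\mu>0$ be any number with $\mu\le\operatorname{Re} z$ for every non-physical root $z$ (for instance, if $p\ge1$, the smallest such real part). Then the following holds. Let $a,L>0$, $x_0\in\mathbb R$, and let $u_0:\mathbb R\to\mathbb C$ be smooth and $L$-periodic (the initial profile of the solution of $u_t+au_x=0$). For $N\ge1$ put $h=L/N$, $x_j=x_0+jh$ $(j\in\mathbb Z)$, and $u_j(\xi)=u_0\big(x_j+\tfrac h2(\xi+1)\big)$ for $\xi\in[-1,1]$. For each $N$ let $U_j(\cdot,t)$ $(j\in\mathbb Z,\ t\ge0)$ be the semi-discrete discontinuous Galerkin solution of degree $p$ with upwind flux on this uniform periodic mesh: $U_j(\cdot,t)$ is a polynomial of degree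 at most $p$, $U_{j+N}=U_j$, and for every polynomial $V$ of degree at most $p$, all $j$ and all $t\ge0$, $$\frac{d}{dt}\int_{-1}^1U_jV\,d\xi+\frac{2a}{h}\big[U_j(1,t)V(1)-U_{j-1}(1,t)V(-1)\big]-\frac{2a}{h}\int_{-1}^1U_jV'\,d\xi=0 .$$ Suppose that the initial data are obtained by the same linear projection on all cells, $U_j(\cdot,0)=Q_N(u_j)$, where $Q_N$ is a linear map from smooth functions on $[-1,1]$ to polynomials of degree at most $p$ with $\sup_{[-1,1]}|Q_Nv|\le BN^s\max_{i\le r}\sup_{[-1,1]}|v^{(i)}|$ for constants $B,r,s$ independent of $N$, and suppose that for some $C_0$, all $N\ge 1$, all $j$ and $k=0,\dots,p$, $$\Big|\int_{-1}^1\big[U_j(\xi,0)-u_j(\xi)\big]P_k(\xi)\,d\xi\Big|\le C_0h^{2p+1-k}.$$ Then, once the non-physical modes have been damped out to order $h^{2p+1}$, the numerical solution is advected with error of order $2p+1$: for every $M$ there is a constant $K$, independent of $N$, $t$, $j$ and $\xi$, such that for all $N\ge1$ and all $t\ge0$ with $e^{-a\mu t/h}\le M h^{2p+1}$, $$\big|U_{j+1}(\xi,t+h/a)-U_j(\xi,t)\big|\le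 K\,h^{2p+1}\qquad\text{for all } j \text{ and all } \xi\in[-1,1].$$ -/

import Mathlib

open Polynomial
open scoped ContDiff

noncomputable section

namespace DGAdvection

/-- The Legendre polynomial `P_k` on `[-1,1]` (Rodrigues' formula, normalised by `P_k(1) = 1`). -/
def legendre (k : ℕ) : ℂ[X] :=
  C ((2 ^ k * (k.factorial : ℂ))⁻¹) * derivative^[k] ((X ^ 2 - 1) ^ k)

/-- The right Radau polynomial `R⁻_{p+1} = P_{p+1} - P_p`. -/
def radau (p : ℕ) : ℂ[X] := legendre (p + 1) - legendre p

/-- `f(z,ξ) = ((-1)^{p+1}/2) ∑_{k=1}^{p+1} 2^k z^{p+1-k} (d^k/dξ^k) R⁻_{p+1}(ξ)`. -/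
def fPoly (p : ℕ) (z ξ : ℂ) : ℂ :=
  (-1) ^ (p + 1) / 2 *
    ∑ k ∈ Finset.Icc 1 (p + 1), 2 ^ k * z ^ (p + 1 - k) * (derivative^[k] (radau p)).eval ξ

/-- `g(z) = z^{p+1} + ((-1)^{p+1}/2) ∑_{k=1}^{p+1} 2^k z^{p+1-k} (d^k/dξ^k) R⁻_{p+1}(-1)`;
`f(z,1)/g(z)` is the `p/(p+1)` Padé approximant of `e^z`. -/
def gPoly (p : ℕ) (z : ℂ) : ℂ := z ^ (p + 1) + fPoly p z (-1)

/-- The non-zero roots `μ_m` of `g(z) - f(z,1)`: the leading coefficients of the non-physical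
numerical frequencies `ω_m = μ_m / h + O(1)`, whose modes behave in time like `e^{-a μ_m t / h}`. -/
def IsNonphysicalRoot (p : ℕ) (z : ℂ) : Prop := z ≠ 0 ∧ gPoly p z - fPoly p z 1 = 0

/-- The function `u` on the cell `[x₀ + j h, x₀ + (j+1) h]`, mapped to the canonical element
`[-1,1]`. -/
def onCell (u : ℝ → ℂ) (x₀ h : ℝ) (j : ℤ) (ξ : ℝ) : ℂ := u (x₀ + j * h + h / 2 * (ξ + 1))

/-- `U j t` (a polynomial in the canonical variable `ξ ∈ [-1,1]`) is the semi-discrete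
discontinuous Galerkin solution of degree `p` with upwind flux of `u_t + a u_x = 0` on a uniform
periodic mesh of `N` cells of size `h`; cells are indexed by `j : ℤ` modulo `N`. -/
structure IsDGSolution (p : ℕ) (a h : ℝ) (N : ℕ) (U : ℤ → ℝ → ℂ[X]) : Prop where
  natDegree_le : ∀ (j : ℤ) (t : ℝ), 0 ≤ t → (U j t).natDegree ≤ p
  periodic : ∀ (j : ℤ) (t : ℝ), 0 ≤ t → U (j + N) t = U j t
  weak_form : ∀ (j : ℤ) (t : ℝ), 0 ≤ t → ∀ V : ℂ[X], V.natDegree ≤ p →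
    HasDerivWithinAt
      (fun s : ℝ => ∫ ξ in (-1 : ℝ)..1, (U j s).eval (ξ : ℂ) * V.eval (ξ : ℂ))
      ((2 * a / h : ℝ) *
          (∫ ξ in (-1 : ℝ)..1, (U j t).eval (ξ : ℂ) * (derivative V).eval (ξ : ℂ))
        - (2 * a / h : ℝ) *
          ((U j t).eval 1 * V.eval 1 - (U (j - 1) t).eval 1 * V.eval (-1)))
      (Set.Ici 0) t

/-- `Q` is a linear operator from smooth functions on the canonical element `[-1,1]` to
polynomials of degree at most `p`, bounded by `B` from the `C^r`-norm to the sup-norm on `[-1,1]`.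
The bound makes `Q v` depend on `v` only through its restriction to `[-1,1]`. -/
structure IsCellProjection (p r : ℕ) (B : ℝ) (Q : (ℝ → ℂ) → ℂ[X]) : Prop where
  natDegree_le : ∀ v : ℝ → ℂ, ContDiff ℝ ∞ v → (Q v).natDegree ≤ p
  map_add : ∀ v w : ℝ → ℂ, ContDiff ℝ ∞ v → ContDiff ℝ ∞ w →
    Q (fun ξ => v ξ + w ξ) = Q v + Q w
  map_smul : ∀ (c : ℂ) (v : ℝ → ℂ), ContDiff ℝ ∞ v → Q (fun ξ => c * v ξ) = C c * Q v
  bound : ∀ v : ℝ → ℂ, ContDiff ℝ ∞ v → ∀ b : ℝ,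
    (∀ i ≤ r, ∀ ξ ∈ Set.Icc (-1 : ℝ) 1, ‖iteratedDeriv i v ξ‖ ≤ b) →
      ∀ ξ ∈ Set.Icc (-1 : ℝ) 1, ‖(Q v).eval (ξ : ℂ)‖ ≤ B * b

end DGAdvection

end

noncomputable section

namespace DGAdvection

/-! ### Integration of polynomials over `[-1,1]` -/

/-! The derivative of the Radau polynomial represents evaluation at `-1`, so the weak form is a
linear system: each cell is driven by `localOp` on itself and by `inflowOp` on its left neighbour.
The discrete Fourier transform in the cell index decouples it. In the rescaled time τ = at/h the
grid mode of angle θ evolves by the flow of `G = upwind p e^{-iθ}`, and its defect from exact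
advection over one cell is `e^{τG}(e^{iθ} e^{G} x - x)`, up to a unimodular factor.

Three properties of `G` carry the proof. It is dissipative in L² (`re_inner_upwind`). It is
symmetric for the bilinear form `∫ x(-ξ) y(ξ) dξ` (`reflectForm_upwind`), so right eigenvectors also
give left ones. Finally, `v = f(iθ, ·)` satisfies `G v + iθ v = O(θ^{2p+2})`, because `f(z,1)/g(z)`
approximates `e^z` to that order (`upwind_mode`, `exists_norm_padeError_le`). At θ = 0 the kernel
consists of the constants and every non-zero eigenvalue is minus a non-physical root; conversely
each such root has an eigenvector, and the dissipation identity makes its real part positive.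

Split `x` into a multiple of `v` and a remainder `y` that the form pairs to zero with `v`. On `v`
the defect is at most the residual. To see that `y` decays, modify `G` in the direction `v` so that
pairing with `v` becomes an exact left eigenvector of eigenvalue -μ (`dampedOp`). The modified
operator decays at any rate ν < μ, uniformly near θ = 0, and Duhamel's formula shows that along this
orbit it differs from `G` only by the residual. Neither diagonalisability nor perturbation of
eigenvalues enters. For θ away from 0 contraction alone is enough.

It remains to sum over the modes. Since one linear projection acts on all cells, it commutes with
differences between cells, so the modes of the data decay faster than any power, up to the factor
`N^s`; interpolating with a uniform bound reduces this factor to `√N`. The price of ν < μ is a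
factor `h^{-1/2}` in the damping. It is repaid because the initial data are within O(h) of
constants, so the remainder `y` is small from the start. -/

theorem continuous_eval_ofReal (P : ℂ[X]) : Continuous fun ξ : ℝ => P.eval (ξ : ℂ) :=
  P.continuous.comp Complex.continuous_ofReal

theorem intervalIntegrable_eval (P : ℂ[X]) (x y : ℝ) :
    IntervalIntegrable (fun ξ : ℝ => P.eval (ξ : ℂ)) MeasureTheory.volume x y :=
  (continuous_eval_ofReal P).intervalIntegrable x y

/-- The integral over `[-1,1]` as a linear functional on polynomials. -/
def cellIntegral : ℂ[X] →ₗ[ℂ] ℂ where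
  toFun P := ∫ ξ in (-1 : ℝ)..1, P.eval (ξ : ℂ)
  map_add' P Q := by
    simp only [eval_add]
    exact intervalIntegral.integral_add (intervalIntegrable_eval P _ _)
      (intervalIntegrable_eval Q _ _)
  map_smul' c P := by simp [eval_smul]

theorem cellIntegral_apply (P : ℂ[X]) : cellIntegral P = ∫ ξ in (-1 : ℝ)..1, P.eval (ξ : ℂ) := rfl

theorem cellIntegral_mul (P Q : ℂ[X]) :
    cellIntegral (P * Q) = ∫ ξ in (-1 : ℝ)..1, P.eval (ξ : ℂ) * Q.eval (ξ : ℂ) := by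
  simp [cellIntegral_apply]

theorem cellIntegral_C_mul (c : ℂ) (P : ℂ[X]) : cellIntegral (C c * P) = c * cellIntegral P := by
  rw [← smul_eq_C_mul, map_smul, smul_eq_mul]

theorem hasDerivAt_eval_ofReal (P : ℂ[X]) (x : ℝ) :
    HasDerivAt (fun ξ : ℝ => P.eval (ξ : ℂ)) ((derivative P).eval (x : ℂ)) x :=
  (P.hasDerivAt (x : ℂ)).comp_ofReal

theorem cellIntegral_derivative (P : ℂ[X]) :
    cellIntegral (derivative P) = P.eval 1 - P.eval (-1) := by
  rw [cellIntegral_apply, intervalIntegral.integral_eq_sub_of_hasDerivAt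
    (fun x _ => hasDerivAt_eval_ofReal P x) (intervalIntegrable_eval _ _ _)]
  simp

theorem cellIntegral_derivative_mul (P Q : ℂ[X]) :
    cellIntegral (derivative P * Q) =
      P.eval 1 * Q.eval 1 - P.eval (-1) * Q.eval (-1) - cellIntegral (P * derivative Q) := by
  have h := cellIntegral_derivative (P * Q)
  rw [derivative_mul, map_add, eval_mul, eval_mul] at h
  rw [← h]; ring

theorem cellIntegral_comp_neg (P : ℂ[X]) : cellIntegral (P.comp (-X)) = cellIntegral P := by
  have h := intervalIntegral.integral_comp_neg (a := -1) (b := 1)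
    (fun ξ : ℝ => P.eval (ξ : ℂ))
  simp only [neg_neg] at h
  rw [cellIntegral_apply, cellIntegral_apply, ← h]
  simp

/-! ### Legendre and Radau polynomials -/

theorem eval_iterate_derivative_X_sub_C_pow_mul (x : ℂ) (k : ℕ) (Q : ℂ[X]) :
    (derivative^[k] ((X - C x) ^ k * Q)).eval x = k.factorial * Q.eval x := by
  induction k generalizing Q with
  | zero => simp
  | succ k ih =>
    have h : derivative ((X - C x) ^ (k + 1) * Q) =
        (X - C x) ^ k * (C ((k : ℂ) + 1) * Q + (X - C x) * derivative Q) := by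
      rw [derivative_mul, derivative_X_sub_C_pow, Nat.add_sub_cancel, pow_succ]
      push_cast
      ring
    rw [Function.iterate_succ_apply, h, ih]
    simp [Nat.factorial_succ]
    ring

theorem legendre_eval_one (k : ℕ) : (legendre k).eval 1 = 1 := by
  have h : ((X : ℂ[X]) ^ 2 - 1) ^ k = (X - C 1) ^ k * (X + 1) ^ k := by
    rw [← mul_pow]; congr 1; simp; ring
  rw [legendre, eval_mul, h, eval_iterate_derivative_X_sub_C_pow_mul]
  have : (k.factorial : ℂ) ≠ 0 := by exact_mod_cast k.factorial_ne_zero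
  simp
  norm_num
  field_simp

theorem legendre_eval_neg_one (k : ℕ) : (legendre k).eval (-1) = (-1) ^ k := by
  have h : ((X : ℂ[X]) ^ 2 - 1) ^ k = (X - C (-1)) ^ k * (X - 1) ^ k := by
    rw [← mul_pow]; congr 1; simp; ring
  rw [legendre, eval_mul, h, eval_iterate_derivative_X_sub_C_pow_mul]
  have : (k.factorial : ℂ) ≠ 0 := by exact_mod_cast k.factorial_ne_zero
  have h2 : ((-1 : ℂ) - 1) ^ k = (-1) ^ k * 2 ^ k := by rw [← mul_pow]; norm_num
  simp [h2]
  field_simp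

theorem monic_X_sq_sub_one_pow (k : ℕ) : (((X : ℂ[X]) ^ 2 - 1) ^ k).Monic := by
  have := (monic_X_pow_sub_C (1 : ℂ) two_ne_zero).pow k
  simpa using this

theorem natDegree_X_sq_sub_one_pow (k : ℕ) : (((X : ℂ[X]) ^ 2 - 1) ^ k).natDegree = 2 * k := by
  have : ((X : ℂ[X]) ^ 2 - C 1).natDegree = 2 := natDegree_X_pow_sub_C
  rw [natDegree_pow]
  simp only [C_1] at this
  rw [this, mul_comm]

theorem natDegree_legendre_le (k : ℕ) : (legendre k).natDegree ≤ k := by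
  refine (natDegree_C_mul_le _ _).trans ((natDegree_iterate_derivative _ _).trans ?_)
  rw [natDegree_X_sq_sub_one_pow]; omega

theorem coeff_legendre_ne_zero (k : ℕ) : (legendre k).coeff k ≠ 0 := by
  have h : (((X : ℂ[X]) ^ 2 - 1) ^ k).coeff (k + k) = 1 := by
    have := (monic_X_sq_sub_one_pow k).coeff_natDegree
    rwa [natDegree_X_sq_sub_one_pow, two_mul] at this
  rw [legendre, coeff_C_mul, coeff_iterate_derivative, h]
  have h1 : (k.factorial : ℂ) ≠ 0 := by exact_mod_cast k.factorial_ne_zero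
  simp [h1]

theorem degree_legendre (k : ℕ) : (legendre k).degree = k :=
  degree_eq_of_le_of_coeff_ne_zero (natDegree_le_iff_degree_le.1 (natDegree_legendre_le k))
    (coeff_legendre_ne_zero k)

theorem eval_iterate_derivative_X_sq_sub_one_pow {j k : ℕ} (hj : j < k) {x : ℂ} (hx : x ^ 2 = 1) :
    (derivative^[j] (((X : ℂ[X]) ^ 2 - 1) ^ k)).eval x = 0 := by
  obtain ⟨q, hq⟩ := pow_sub_dvd_iterate_derivative_pow ((X : ℂ[X]) ^ 2 - 1) k j
  rw [hq]
  have : k - j ≠ 0 := by omega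
  simp [hx, this]

/-- Integrate by parts `j` times: the boundary terms vanish because `±1` are zeros of order `k`, and
`V` is differentiated away. -/
theorem cellIntegral_iterate_derivative_mul_eq_zero {j k : ℕ} (hj : j ≤ k) (V : ℂ[X])
    (hV : V.degree < j) :
    cellIntegral (derivative^[j] (((X : ℂ[X]) ^ 2 - 1) ^ k) * V) = 0 := by
  induction j generalizing V with
  | zero =>
    have : V = 0 := by simpa using hV
    simp [this]
  | succ j ih =>
    rw [Function.iterate_succ_apply', cellIntegral_derivative_mul,
      eval_iterate_derivative_X_sq_sub_one_pow (by omega) (by norm_num),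
      eval_iterate_derivative_X_sq_sub_one_pow (by omega) (by norm_num), ih (by omega)]
    · simp
    · by_cases h0 : V = 0
      · simp [h0]
      · by_cases hd : derivative V = 0
        · simp [hd]
        · have h1 := degree_derivative_lt h0
          rw [degree_eq_natDegree h0] at hV h1
          rw [degree_eq_natDegree hd] at h1 ⊢
          norm_cast at *
          omega

theorem cellIntegral_legendre_mul_eq_zero (k : ℕ) (V : ℂ[X]) (hV : V.degree < k) :
    cellIntegral (legendre k * V) = 0 := by
  rw [legendre, mul_assoc, cellIntegral_C_mul,
    cellIntegral_iterate_derivative_mul_eq_zero le_rfl V hV, mul_zero]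

theorem radau_eval_one (p : ℕ) : (radau p).eval 1 = 0 := by
  simp [radau, legendre_eval_one]

theorem radau_eval_neg_one (p : ℕ) : (radau p).eval (-1) = 2 * (-1) ^ (p + 1) := by
  simp [radau, legendre_eval_neg_one, pow_succ]
  ring

theorem natDegree_radau_le (p : ℕ) : (radau p).natDegree ≤ p + 1 :=
  (natDegree_sub_le _ _).trans
    (max_le (natDegree_legendre_le _) ((natDegree_legendre_le _).trans p.le_succ))

theorem coeff_radau_ne_zero (p : ℕ) : (radau p).coeff (p + 1) ≠ 0 := by
  rw [radau, coeff_sub, coeff_eq_zero_of_natDegree_lt (n := p + 1) (p := legendre p)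
    ((natDegree_legendre_le p).trans_lt p.lt_succ_self), sub_zero]
  exact coeff_legendre_ne_zero _

theorem cellIntegral_radau_mul_eq_zero (p : ℕ) (V : ℂ[X]) (hV : V.degree < p) :
    cellIntegral (radau p * V) = 0 := by
  rw [radau, sub_mul, map_sub, cellIntegral_legendre_mul_eq_zero p V hV,
    cellIntegral_legendre_mul_eq_zero (p + 1) V (hV.trans (by exact_mod_cast p.lt_succ_self)),
    sub_zero]

/-- The derivative of the Radau polynomial represents evaluation at `-1`. -/
theorem cellIntegral_derivative_radau_mul (p : ℕ) (V : ℂ[X]) (hV : V.natDegree ≤ p) :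
    cellIntegral (derivative (radau p) * V) = 2 * (-1) ^ p * V.eval (-1) := by
  rw [cellIntegral_derivative_mul, radau_eval_one, radau_eval_neg_one,
    cellIntegral_radau_mul_eq_zero]
  · ring
  · rcases Nat.eq_zero_or_pos V.natDegree with h0 | h0
    · rw [natDegree_eq_zero] at h0
      obtain ⟨c, rfl⟩ := h0
      simp
    · exact (degree_le_natDegree).trans_lt (by
        exact_mod_cast (natDegree_derivative_lt h0.ne').trans_le hV)

/-! ### The cell space with its `L²` inner product -/

/-- Polynomials of degree at most `p` on the canonical element. -/
abbrev Cell (p : ℕ) : Type := degreeLT ℂ (p + 1)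

theorem mem_degreeLT_succ {p : ℕ} {P : ℂ[X]} : P ∈ degreeLT ℂ (p + 1) ↔ P.natDegree ≤ p := by
  rw [mem_degreeLT, natDegree_le_iff_degree_le]
  by_cases h : P = 0
  · simp [h]
  · rw [degree_eq_natDegree h]
    norm_cast
    omega

theorem Cell.natDegree_le {p : ℕ} (x : Cell p) : (x : ℂ[X]).natDegree ≤ p :=
  mem_degreeLT_succ.1 x.2

instance (p : ℕ) : FiniteDimensional ℂ (Cell p) :=
  (degreeLTEquiv ℂ (p + 1)).symm.finiteDimensional

/-- The polynomial with conjugated coefficients. -/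
def conjPoly (P : ℂ[X]) : ℂ[X] := P.map (starRingEnd ℂ)

theorem eval_conjPoly_ofReal (P : ℂ[X]) (ξ : ℝ) :
    (conjPoly P).eval (ξ : ℂ) = starRingEnd ℂ (P.eval (ξ : ℂ)) := by
  rw [conjPoly, eval_map, ← coe_eval₂RingHom, eval, hom_eval₂]
  simp

theorem eval_conjPoly_one (P : ℂ[X]) : (conjPoly P).eval 1 = starRingEnd ℂ (P.eval 1) := by
  simpa using eval_conjPoly_ofReal P 1

theorem eval_conjPoly_neg_one (P : ℂ[X]) :
    (conjPoly P).eval (-1) = starRingEnd ℂ (P.eval (-1)) := by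
  simpa using eval_conjPoly_ofReal P (-1)

theorem conjPoly_conjPoly (P : ℂ[X]) : conjPoly (conjPoly P) = P := by
  ext; simp [conjPoly]

theorem natDegree_conjPoly_le (P : ℂ[X]) : (conjPoly P).natDegree ≤ P.natDegree :=
  natDegree_map_le

theorem derivative_conjPoly (P : ℂ[X]) : derivative (conjPoly P) = conjPoly (derivative P) :=
  derivative_map _ _

theorem conjPoly_mul (P Q : ℂ[X]) : conjPoly (P * Q) = conjPoly P * conjPoly Q :=
  Polynomial.map_mul _

theorem cellIntegral_conjPoly (P : ℂ[X]) :
    cellIntegral (conjPoly P) = starRingEnd ℂ (cellIntegral P) := by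
  simp only [cellIntegral_apply, eval_conjPoly_ofReal]
  rw [intervalIntegral.integral_of_le (by norm_num), intervalIntegral.integral_of_le (by norm_num),
    integral_conj]

theorem cellIntegral_conjPoly_mul_self (P : ℂ[X]) :
    cellIntegral (conjPoly P * P) = ((∫ ξ in (-1 : ℝ)..1, ‖P.eval (ξ : ℂ)‖ ^ 2 : ℝ) : ℂ) := by
  rw [cellIntegral_mul, ← intervalIntegral.integral_ofReal]
  congr 1
  ext ξ
  rw [eval_conjPoly_ofReal, Complex.conj_mul']
  push_cast
  rfl

theorem eq_zero_of_integral_norm_sq_eq_zero (P : ℂ[X])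
    (h : ∫ ξ in (-1 : ℝ)..1, ‖P.eval (ξ : ℂ)‖ ^ 2 = 0) : P = 0 := by
  by_contra hP
  have hz : ∀ ξ ∈ Set.Icc (-1 : ℝ) 1, P.eval (ξ : ℂ) = 0 := by
    by_contra! hc
    obtain ⟨ξ, hξ, hne⟩ := hc
    have := intervalIntegral.integral_pos (f := fun ξ : ℝ => ‖P.eval (ξ : ℂ)‖ ^ 2) (a := -1)
      (b := 1) (by norm_num) (((continuous_eval_ofReal P).norm.pow 2).continuousOn)
      (fun x _ => by positivity) ⟨ξ, hξ, by positivity⟩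
    linarith
  have hinf : (((↑) : ℝ → ℂ) '' Set.Icc (-1 : ℝ) 1).Infinite :=
    (Set.Icc_infinite (by norm_num)).image Complex.ofReal_injective.injOn
  refine hP (eq_zero_of_infinite_isRoot P (hinf.mono ?_))
  rintro _ ⟨ξ, hξ, rfl⟩
  exact hz ξ hξ

/-- The `L²(-1,1)` inner product on the cell space. -/
abbrev cellCore (p : ℕ) : InnerProductSpace.Core ℂ (Cell p) where
  inner x y := cellIntegral (conjPoly x * y)
  conj_inner_symm x y := by
    rw [← cellIntegral_conjPoly, conjPoly_mul, conjPoly_conjPoly, mul_comm]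
  re_inner_nonneg x := by
    rw [cellIntegral_conjPoly_mul_self]
    simp only [RCLike.re_to_complex, Complex.ofReal_re]
    exact intervalIntegral.integral_nonneg (by norm_num) fun _ _ => by positivity
  add_left x y z := by simp [conjPoly, Polynomial.map_add, add_mul]
  smul_left x y r := by simp [conjPoly, Polynomial.map_smul]
  definite x h := by
    rw [cellIntegral_conjPoly_mul_self, Complex.ofReal_eq_zero] at h
    exact Subtype.ext (eq_zero_of_integral_norm_sq_eq_zero _ h)

instance (p : ℕ) : NormedAddCommGroup (Cell p) := (cellCore p).toNormedAddCommGroup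

instance (p : ℕ) : InnerProductSpace ℂ (Cell p) := InnerProductSpace.ofCore (cellCore p).toCore

instance (p : ℕ) : CompleteSpace (Cell p) := FiniteDimensional.complete ℂ _

theorem Cell.inner_def {p : ℕ} (x y : Cell p) :
    inner ℂ x y = cellIntegral (conjPoly x * y) := rfl

theorem Cell.norm_sq {p : ℕ} (x : Cell p) :
    ‖x‖ ^ 2 = ∫ ξ in (-1 : ℝ)..1, ‖(x : ℂ[X]).eval (ξ : ℂ)‖ ^ 2 := by
  rw [← inner_self_eq_norm_sq (𝕜 := ℂ), Cell.inner_def, cellIntegral_conjPoly_mul_self]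
  simp

theorem Cell.norm_le_of_forall_eval {p : ℕ} (x : Cell p) {b : ℝ}
    (h : ∀ ξ ∈ Set.Icc (-1 : ℝ) 1, ‖(x : ℂ[X]).eval (ξ : ℂ)‖ ≤ b) : ‖x‖ ≤ 2 * b := by
  have hb : 0 ≤ b := (norm_nonneg _).trans (h 0 (by simp))
  have h1 : ‖x‖ ^ 2 ≤ ∫ _ in (-1 : ℝ)..1, b ^ 2 := by
    rw [Cell.norm_sq]
    refine intervalIntegral.integral_mono_on (by norm_num)
      (((continuous_eval_ofReal _).norm.pow 2).intervalIntegrable _ _) (by simp) fun ξ hξ => ?_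
    gcongr
    exact h ξ hξ
  rw [intervalIntegral.integral_const, smul_eq_mul] at h1
  nlinarith [norm_nonneg x]

theorem Cell.exists_eval_le (p : ℕ) : ∃ c : ℝ, 0 ≤ c ∧ ∀ x : Cell p, ∀ ξ ∈ Set.Icc (-1 : ℝ) 1,
    ‖(x : ℂ[X]).eval (ξ : ℂ)‖ ≤ c * ‖x‖ := by
  let e : Cell p →L[ℂ] (Fin (p + 1) → ℂ) :=
    LinearMap.toContinuousLinearMap (degreeLTEquiv ℂ (p + 1)).toLinearMap
  refine ⟨(p + 1) * ‖e‖, by positivity, fun x ξ hξ => ?_⟩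
  rw [eval_eq_sum_degreeLTEquiv x.2]
  calc ‖∑ i, degreeLTEquiv ℂ (p + 1) x i * (ξ : ℂ) ^ (i : ℕ)‖
      ≤ ∑ i : Fin (p + 1), ‖e‖ * ‖x‖ := by
        refine norm_sum_le_of_le _ fun i _ => ?_
        rw [norm_mul, norm_pow, Complex.norm_real, Real.norm_eq_abs]
        have h1 : |ξ| ^ (i : ℕ) ≤ 1 := pow_le_one₀ (abs_nonneg _) (abs_le.2 hξ)
        have h2 : ‖e x i‖ ≤ ‖e‖ * ‖x‖ := (norm_le_pi_norm _ i).trans (e.le_opNorm x)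
        exact (mul_le_mul h2 h1 (by positivity) (by positivity)).trans_eq (mul_one _)
    _ = (p + 1) * ‖e‖ * ‖x‖ := by simp [mul_assoc]

/-- The moments against the Legendre polynomials control the norm. -/
theorem Cell.exists_norm_le_of_moments (p : ℕ) : ∃ c : ℝ, 0 ≤ c ∧ ∀ (x : Cell p) (b : ℝ), 0 ≤ b →
    (∀ k ≤ p, ‖cellIntegral ((x : ℂ[X]) * legendre k)‖ ≤ b) → ‖x‖ ≤ c * b := by
  let m : Cell p →ₗ[ℂ] (Fin (p + 1) → ℂ) := LinearMap.pi fun k =>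
    cellIntegral ∘ₗ (LinearMap.mulRight ℂ (legendre k)) ∘ₗ (degreeLT ℂ (p + 1)).subtype
  have hm : ∀ x k, m x k = cellIntegral ((x : ℂ[X]) * legendre k) := fun x k => rfl
  let S : Polynomial.Sequence ℂ := ⟨legendre, degree_legendre⟩
  have hspan := S.span_degreeLE (m := p)
    (fun i _ => (leadingCoeff_ne_zero.2 (S.ne_zero i)).isUnit)
  -- The Legendre polynomials span the degrees up to `p`, so vanishing moments make `x` orthogonal
  -- to every polynomial of the cell space; testing with the conjugate of `x` gives norm zero.
  have hker : LinearMap.ker m = ⊥ := by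
    rw [LinearMap.ker_eq_bot']
    intro x hx
    let φ : ℂ[X] →ₗ[ℂ] ℂ := cellIntegral ∘ₗ LinearMap.mulLeft ℂ (x : ℂ[X])
    have h1 : degreeLE ℂ p ≤ LinearMap.ker φ := by
      rw [← hspan, Submodule.span_le]
      rintro _ ⟨k, hk, rfl⟩
      have := congrFun hx ⟨k, Nat.lt_succ_of_le hk⟩
      rwa [hm] at this
    have h2 : conjPoly (x : ℂ[X]) ∈ degreeLE ℂ p := by
      rw [mem_degreeLE, ← natDegree_le_iff_degree_le]
      exact (natDegree_conjPoly_le _).trans x.natDegree_le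
    have h3 := h1 h2
    rw [LinearMap.mem_ker] at h3
    have h4 : inner ℂ x x = (0 : ℂ) := by
      rw [Cell.inner_def, mul_comm]; exact h3
    exact inner_self_eq_zero.1 h4
  obtain ⟨K, -, hK⟩ := m.exists_antilipschitzWith hker
  refine ⟨K, K.2, fun x b hb h => ?_⟩
  have h1 := hK.le_mul_dist x 0
  simp only [dist_zero_right, map_zero] at h1
  refine h1.trans (mul_le_mul_of_nonneg_left ?_ K.2)
  rw [pi_norm_le_iff_of_nonneg hb]
  intro k
  rw [hm]
  exact h k (Nat.le_of_lt_succ k.2)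

/-! ### The upwind operator on a cell -/

/-- The derivatives `R^{(k+1)}` of the Radau polynomial as elements of the cell space. -/
def radauDeriv (p k : ℕ) : Cell p :=
  ⟨derivative^[k + 1] (radau p), mem_degreeLT_succ.2 <|
    (natDegree_iterate_derivative _ _).trans (by have := natDegree_radau_le p; omega)⟩

theorem coe_radauDeriv (p k : ℕ) : (radauDeriv p k : ℂ[X]) = derivative^[k + 1] (radau p) := rfl

/-- The part of the upwind operator that acts on the cell itself. -/
def localOp (p : ℕ) : Cell p →L[ℂ] Cell p :=
  LinearMap.toContinuousLinearMap
    { toFun := fun x => ⟨(-2 : ℂ) • derivative (x : ℂ[X]), mem_degreeLT_succ.2 <|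
          (natDegree_smul_le _ _).trans <| (natDegree_derivative_le _).trans <|
            (Nat.sub_le _ _).trans x.natDegree_le⟩ +
          ((-1) ^ (p + 1) * (x : ℂ[X]).eval (-1)) • radauDeriv p 0
      map_add' := fun x y => by
        ext1
        simp only [Submodule.coe_add, Submodule.coe_smul, derivative_add, eval_add]
        module
      map_smul' := fun c x => by
        ext1
        simp only [Submodule.coe_add, Submodule.coe_smul, derivative_smul, eval_smul, smul_eq_mul,
          RingHom.id_apply]
        module }

/-- The part of the upwind operator that takes the outflow value of the left neighbour. -/
def inflowOp (p : ℕ) : Cell p →L[ℂ] Cell p :=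
  LinearMap.toContinuousLinearMap
    { toFun := fun x => (-((-1) ^ (p + 1) * (x : ℂ[X]).eval 1)) • radauDeriv p 0
      map_add' := fun x y => by
        simp only [Submodule.coe_add, eval_add]
        module
      map_smul' := fun c x => by
        simp only [Submodule.coe_smul, eval_smul, smul_eq_mul, RingHom.id_apply]
        module }

/-- The symbol of the upwind operator; `w` is the factor between a cell and its left neighbour. -/
def upwind (p : ℕ) (w : ℂ) : Cell p →L[ℂ] Cell p := localOp p + w • inflowOp p

theorem coe_localOp (p : ℕ) (x : Cell p) : (localOp p x : ℂ[X]) =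
    (-2 : ℂ) • derivative (x : ℂ[X]) +
      ((-1) ^ (p + 1) * (x : ℂ[X]).eval (-1)) • derivative (radau p) := rfl

theorem coe_inflowOp (p : ℕ) (x : Cell p) : (inflowOp p x : ℂ[X]) =
    (-((-1) ^ (p + 1) * (x : ℂ[X]).eval 1)) • derivative (radau p) := rfl

theorem coe_upwind (p : ℕ) (w : ℂ) (x : Cell p) : (upwind p w x : ℂ[X]) =
    (-2 : ℂ) • derivative (x : ℂ[X]) +
      ((-1) ^ (p + 1) * ((x : ℂ[X]).eval (-1) - w * (x : ℂ[X]).eval 1)) •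
        derivative (radau p) := by
  simp only [upwind, add_apply, smul_apply, Submodule.coe_add,
    Submodule.coe_smul, coe_localOp, coe_inflowOp]
  module

theorem neg_one_pow_succ_mul_pow (p : ℕ) : (-1 : ℂ) ^ (p + 1) * (-1) ^ p = -1 := by
  rw [← pow_add, show p + 1 + p = 2 * p + 1 by ring, pow_succ, pow_mul]; norm_num

theorem cellIntegral_localOp_mul (p : ℕ) (x : Cell p) (V : ℂ[X]) (hV : V.natDegree ≤ p) :
    cellIntegral ((localOp p x : ℂ[X]) * V) =
      2 * (cellIntegral ((x : ℂ[X]) * derivative V) - (x : ℂ[X]).eval 1 * V.eval 1) := by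
  rw [coe_localOp, add_mul, map_add, smul_mul_assoc, smul_mul_assoc, map_smul, map_smul,
    cellIntegral_derivative_radau_mul p V hV, cellIntegral_derivative_mul]
  simp only [smul_eq_mul]
  linear_combination (2 * (x : ℂ[X]).eval (-1) * V.eval (-1)) * neg_one_pow_succ_mul_pow p

theorem cellIntegral_inflowOp_mul (p : ℕ) (x : Cell p) (V : ℂ[X]) (hV : V.natDegree ≤ p) :
    cellIntegral ((inflowOp p x : ℂ[X]) * V) = 2 * ((x : ℂ[X]).eval 1 * V.eval (-1)) := by
  rw [coe_inflowOp, smul_mul_assoc, map_smul, cellIntegral_derivative_radau_mul p V hV]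
  simp only [smul_eq_mul]
  linear_combination (-2 * (x : ℂ[X]).eval 1 * V.eval (-1)) * neg_one_pow_succ_mul_pow p

theorem cellIntegral_upwind_mul (p : ℕ) (w : ℂ) (x : Cell p) (V : ℂ[X]) (hV : V.natDegree ≤ p) :
    cellIntegral ((upwind p w x : ℂ[X]) * V) =
      2 * (cellIntegral ((x : ℂ[X]) * derivative V) - (x : ℂ[X]).eval 1 * V.eval 1
        + w * ((x : ℂ[X]).eval 1 * V.eval (-1))) := by
  simp only [upwind, add_apply, smul_apply, Submodule.coe_add,
    Submodule.coe_smul, add_mul, smul_mul_assoc, map_add, map_smul,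
    cellIntegral_localOp_mul p x V hV, cellIntegral_inflowOp_mul p x V hV, smul_eq_mul]
  ring

/-- Energy identity: integration by parts leaves only boundary terms, and `‖w‖ = 1` completes them
to the square of the jump between neighbouring cells. -/
theorem re_inner_upwind (p : ℕ) {w : ℂ} (hw : ‖w‖ = 1) (x : Cell p) :
    (inner ℂ x (upwind p w x)).re = -‖(x : ℂ[X]).eval (-1) - w * (x : ℂ[X]).eval 1‖ ^ 2 := by
  set P : ℂ[X] := x.1 with hP
  have h1 : cellIntegral (derivative P * conjPoly P) =
      starRingEnd ℂ (cellIntegral (P * derivative (conjPoly P))) := by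
    rw [← cellIntegral_conjPoly, conjPoly_mul, derivative_conjPoly, conjPoly_conjPoly, mul_comm]
  rw [cellIntegral_derivative_mul, eval_conjPoly_one, eval_conjPoly_neg_one] at h1
  rw [Cell.inner_def, mul_comm, cellIntegral_upwind_mul p w x _
    ((natDegree_conjPoly_le _).trans x.natDegree_le), eval_conjPoly_one, eval_conjPoly_neg_one]
  rw [← hP]
  set I := cellIntegral (P * derivative (conjPoly P))
  have h2 := congrArg Complex.re h1
  have hw2 : w.re * w.re + w.im * w.im = 1 := by
    rw [← Complex.normSq_apply, Complex.normSq_eq_norm_sq, hw]; norm_num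
  rw [← Complex.normSq_eq_norm_sq, Complex.normSq_apply]
  simp only [Complex.sub_re, Complex.mul_re, Complex.conj_re, Complex.conj_im, Complex.add_re,
    Complex.sub_im, Complex.mul_im, Complex.re_ofNat, Complex.im_ofNat] at h2 ⊢
  linear_combination (-h2) + ((P.eval 1).re ^ 2 + (P.eval 1).im ^ 2) * hw2

/-- The bilinear form `∫ x(-ξ) y(ξ) dξ`. -/
def reflectForm (p : ℕ) : Cell p →L[ℂ] Cell p →L[ℂ] ℂ :=
  LinearMap.toContinuousBilinearMap <|
    LinearMap.mk₂ ℂ (fun x y : Cell p => cellIntegral ((x : ℂ[X]).comp (-X) * y))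
      (fun x y z => by simp [add_comp, add_mul]) (fun c x y => by simp [smul_comp])
      (fun x y z => by simp [mul_add]) (fun c x y => by simp)

theorem reflectForm_apply (p : ℕ) (x y : Cell p) :
    reflectForm p x y = cellIntegral ((x : ℂ[X]).comp (-X) * y) := rfl

theorem natDegree_comp_neg_X (P : ℂ[X]) : (P.comp (-X)).natDegree = P.natDegree := by
  rw [natDegree_comp]; simp

/-- Reflection reverses the direction of transport and so does transposition; together they cancel.
No conjugation is involved, so the symmetry holds for every complex `w`, and pairing with a right
eigenvector is a left eigenvector. -/
theorem reflectForm_upwind (p : ℕ) (w : ℂ) (x y : Cell p) :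
    reflectForm p (upwind p w x) y = reflectForm p x (upwind p w y) := by
  have h1 : reflectForm p (upwind p w x) y =
      cellIntegral ((upwind p w x : ℂ[X]) * (y : ℂ[X]).comp (-X)) := by
    rw [reflectForm_apply, ← cellIntegral_comp_neg, mul_comp, comp_assoc]
    simp
  have h2 : cellIntegral ((y : ℂ[X]) * derivative ((x : ℂ[X]).comp (-X))) =
      - cellIntegral (derivative (x : ℂ[X]) * (y : ℂ[X]).comp (-X)) := by
    rw [← cellIntegral_comp_neg, mul_comp, derivative_comp, mul_comp, comp_assoc]
    simp [mul_comm]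
  rw [h1, cellIntegral_upwind_mul p w x _ ((natDegree_comp_neg_X _).trans_le y.natDegree_le),
    reflectForm_apply, mul_comm ((x : ℂ[X]).comp (-X)),
    cellIntegral_upwind_mul p w y _ ((natDegree_comp_neg_X _).trans_le x.natDegree_le), h2,
    cellIntegral_derivative_mul]
  simp
  ring

/-! ### The modes -/

/-- The polynomial `f(z, ·)` as an element of the cell space. -/
def mode (p : ℕ) (z : ℂ) : Cell p :=
  ∑ k ∈ Finset.range (p + 1), ((-1) ^ (p + 1) / 2 * (2 ^ (k + 1) * z ^ (p - k))) • radauDeriv p k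

theorem coe_mode (p : ℕ) (z : ℂ) : (mode p z : ℂ[X]) = ∑ k ∈ Finset.range (p + 1),
    ((-1) ^ (p + 1) / 2 * (2 ^ (k + 1) * z ^ (p - k))) • derivative^[k + 1] (radau p) := by
  simp [mode, coe_radauDeriv]

theorem eval_mode (p : ℕ) (z ξ : ℂ) : (mode p z : ℂ[X]).eval ξ = fPoly p z ξ := by
  have h : Finset.Icc 1 (p + 1) = Finset.Ico 1 (p + 2) := by ext; simp; omega
  rw [coe_mode, fPoly, h, Finset.sum_Ico_eq_sum_range, eval_finsetSum, Finset.mul_sum]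
  refine Finset.sum_congr rfl fun k _ => ?_
  rw [eval_smul, smul_eq_mul, add_comm 1 k, Nat.add_sub_add_right, mul_assoc]

theorem iterate_derivative_radau_eq_zero (p : ℕ) : derivative^[p + 2] (radau p) = 0 :=
  iterate_derivative_eq_zero ((natDegree_radau_le p).trans_lt (by omega))

/-- The coefficients of the mode are chosen so that this sum telescopes; the last term carries a
derivative of order `p + 2` of the Radau polynomial and vanishes. -/
theorem smul_mode_sub (p : ℕ) (z : ℂ) :
    z • (mode p z : ℂ[X]) - (2 : ℂ) • derivative (mode p z : ℂ[X]) =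
      ((-1) ^ (p + 1) * z ^ (p + 1)) • derivative (radau p) := by
  let b : ℕ → ℂ[X] := fun k =>
    ((-1) ^ (p + 1) / 2 * (2 ^ (k + 1) * z ^ (p + 1 - k))) • derivative^[k + 1] (radau p)
  have hb : ∀ k ∈ Finset.range (p + 1),
      z • (((-1) ^ (p + 1) / 2 * (2 ^ (k + 1) * z ^ (p - k))) • derivative^[k + 1] (radau p)) -
      (2 : ℂ) • derivative (((-1) ^ (p + 1) / 2 * (2 ^ (k + 1) * z ^ (p - k))) •
        derivative^[k + 1] (radau p)) = b k - b (k + 1) := by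
    intro k hk
    have hk' : k ≤ p := Nat.le_of_lt_succ (Finset.mem_range.1 hk)
    have e : p + 1 - k = (p - k) + 1 := by omega
    simp only [b, Nat.add_sub_add_right, e, derivative_smul]
    rw [← Function.iterate_succ_apply' derivative (k + 1)]
    module
  rw [coe_mode, derivative_sum, Finset.smul_sum, Finset.smul_sum, ← Finset.sum_sub_distrib,
    Finset.sum_congr rfl hb, Finset.sum_range_sub']
  have : derivative^[p + 1 + 1] (radau p) = 0 := iterate_derivative_radau_eq_zero p
  simp only [b, this, smul_zero, sub_zero]
  simp only [Nat.sub_zero, zero_add, Function.iterate_one, pow_one]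
  congr 1
  ring

/-- The mode is an eigenvector for the eigenvalue `-z` up to the scalar `g(z) - w f(z,1)`. At `w =
1` this scalar vanishes at the non-physical roots; at `w = e^{-z}` it is the Padé error. -/
theorem upwind_mode (p : ℕ) (w z : ℂ) : upwind p w (mode p z) =
    -(z • mode p z) + ((-1) ^ (p + 1) * (gPoly p z - w * fPoly p z 1)) • radauDeriv p 0 := by
  ext1
  rw [coe_upwind]
  have h := smul_mode_sub p z
  simp only [Submodule.coe_add, Submodule.coe_neg, Submodule.coe_smul, coe_radauDeriv, eval_mode,
    gPoly, zero_add, Function.iterate_one]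
  linear_combination (norm := module) h

theorem mode_zero_ne_zero (p : ℕ) : ∃ c : ℂ, c ≠ 0 ∧ (mode p 0 : ℂ[X]) = C c := by
  have h1 : (derivative^[p + 1] (radau p)).natDegree ≤ 0 :=
    (natDegree_iterate_derivative _ _).trans (by have := natDegree_radau_le p; omega)
  have h2 := eq_C_of_natDegree_le_zero h1
  refine ⟨(-1) ^ (p + 1) / 2 * 2 ^ (p + 1) * (derivative^[p + 1] (radau p)).coeff 0, ?_, ?_⟩
  · refine mul_ne_zero (by simp) ?_
    rw [coeff_iterate_derivative, zero_add, nsmul_eq_mul]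
    exact mul_ne_zero (by simp [Nat.descFactorial_eq_zero_iff_lt])
      (coeff_radau_ne_zero p)
  · rw [coe_mode, Finset.sum_range_succ, Finset.sum_eq_zero]
    · rw [h2, smul_C]
      simp
    · intro k hk
      have : p - k ≠ 0 := by have := Finset.mem_range.1 hk; omega
      simp [this]

theorem reflectForm_mode_zero_ne_zero (p : ℕ) {x : Cell p} {c : ℂ} (hc : c ≠ 0)
    (hx : (x : ℂ[X]) = C c) : reflectForm p (mode p 0) x ≠ 0 := by
  obtain ⟨d, hd, hm⟩ := mode_zero_ne_zero p
  rw [reflectForm_apply, hm, hx, C_comp, ← C_mul, cellIntegral_apply]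
  simp [hc, hd]

theorem differentiable_mode (p : ℕ) : Differentiable ℂ (mode p) := by
  unfold mode
  fun_prop

/-! ### Non-physical roots and the spectrum of the periodic cell operator -/

theorem eq_zero_of_smul_eq_derivative {z : ℂ} (hz : z ≠ 0) {P : ℂ[X]}
    (h : z • P - (2 : ℂ) • derivative P = 0) : P = 0 := by
  by_contra hP
  have h1 : (z • P).degree = ((2 : ℂ) • derivative P).degree := by rw [sub_eq_zero.1 h]
  rw [degree_smul_of_smul_regular _ (IsSMulRegular.of_ne_zero hz),
    degree_smul_of_smul_regular _ (IsSMulRegular.of_ne_zero two_ne_zero)] at h1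
  exact (degree_derivative_lt hP).ne h1.symm

/-- The eigenvector and the mode solve the same first-order equation up to scalars, and `z • P = 2 •
P'` has no non-zero polynomial solution when `z ≠ 0`. Hence they are proportional, and comparing
end-point values gives the equation of the roots. -/
theorem isNonphysicalRoot_of_upwind_eq {p : ℕ} {x : Cell p} (hx : x ≠ 0) {c : ℂ} (hc : c ≠ 0)
    (h : upwind p 1 x = c • x) : IsNonphysicalRoot p (-c) := by
  refine ⟨neg_ne_zero.2 hc, ?_⟩
  set P : ℂ[X] := x.1 with hP
  set z := -c with hz
  have hz0 : z ≠ 0 := neg_ne_zero.2 hc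
  set J := P.eval (-1) - P.eval 1 with hJ
  have h1 : (-2 : ℂ) • derivative P + ((-1) ^ (p + 1) * J) • derivative (radau p) = c • P := by
    have := congrArg (Subtype.val) h
    rw [coe_upwind, one_mul] at this
    exact this
  have hP0 : P ≠ 0 := fun h0 => hx (Subtype.ext h0)
  -- Without a jump the equation is homogeneous and forces `P = 0`.
  have hJ0 : J ≠ 0 := by
    intro h0
    refine hP0 (eq_zero_of_smul_eq_derivative hz0 ?_)
    rw [h0] at h1
    rw [hz]
    linear_combination (norm := module) h1
  have h2 : z ^ (p + 1) • P + J • (mode p z : ℂ[X]) = 0 := by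
    refine eq_zero_of_smul_eq_derivative hz0 ?_
    have h3 := smul_mode_sub p z
    have h4 : z • P - (2 : ℂ) • derivative P = -(((-1) ^ (p + 1) * J) • derivative (radau p)) := by
      rw [hz]
      linear_combination (norm := module) h1
    have e : z • (z ^ (p + 1) • P + J • (mode p z : ℂ[X])) -
        (2 : ℂ) • derivative (z ^ (p + 1) • P + J • (mode p z : ℂ[X])) =
        z ^ (p + 1) • (z • P - (2 : ℂ) • derivative P) +
        J • (z • (mode p z : ℂ[X]) - (2 : ℂ) • derivative (mode p z : ℂ[X])) := by
      rw [derivative_add, derivative_smul, derivative_smul]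
      module
    rw [e, h3, h4]
    module
  have e1 := congrArg (eval 1) h2
  have e2 := congrArg (eval (-1)) h2
  simp only [eval_add, eval_smul, smul_eq_mul, eval_mode, eval_zero] at e1 e2
  have : J * (gPoly p z - fPoly p z 1) = 0 := by
    rw [gPoly]
    linear_combination e2 - e1 + z ^ (p + 1) * hJ
  exact (mul_eq_zero.1 this).resolve_left hJ0

/-- The mode of a root is an eigenvector for `w = 1`, and its jump is `-z ^ (p + 1) ≠ 0`; the energy
identity then reads `Re z ‖mode‖² = |z^{p+1}|²`. -/
theorem IsNonphysicalRoot.re_pos {p : ℕ} {z : ℂ} (h : IsNonphysicalRoot p z) : 0 < z.re := by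
  have h1 : upwind p 1 (mode p z) = -(z • mode p z) := by
    rw [upwind_mode, one_mul, h.2]; simp
  have h2 := re_inner_upwind p (w := 1) (by simp) (mode p z)
  have hJ : fPoly p z (-1) - fPoly p z 1 = -z ^ (p + 1) := by
    have := h.2
    rw [gPoly] at this
    linear_combination this
  rw [h1, inner_neg_right, inner_smul_right, inner_self_eq_norm_sq_to_K, one_mul, eval_mode,
    eval_mode, hJ] at h2
  have h3 : 0 < ‖-z ^ (p + 1)‖ ^ 2 := by
    have := h.1
    rw [norm_neg, norm_pow]
    positivity
  have h4 : (z * ((‖mode p z‖ : ℝ) : ℂ) ^ 2).re = z.re * ‖mode p z‖ ^ 2 := by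
    rw [← Complex.ofReal_pow, Complex.re_mul_ofReal]
  have h5 : z.re * ‖mode p z‖ ^ 2 = ‖-z ^ (p + 1)‖ ^ 2 := by
    rw [← h4]
    simp only [Complex.neg_re] at h2
    exact neg_injective h2
  by_contra hneg
  nlinarith [sq_nonneg ‖mode p z‖]

theorem exists_eq_C_of_upwind_eq_zero {p : ℕ} {x : Cell p} (h : upwind p 1 x = 0) :
    ∃ c : ℂ, (x : ℂ[X]) = C c := by
  have h1 := re_inner_upwind p (w := 1) (by simp) x
  rw [h, inner_zero_right, one_mul] at h1
  have hJ : (x : ℂ[X]).eval (-1) - (x : ℂ[X]).eval 1 = 0 := by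
    have : ‖(x : ℂ[X]).eval (-1) - (x : ℂ[X]).eval 1‖ ^ 2 = 0 := by simpa using h1
    simpa using this
  have h2 := congrArg Subtype.val h
  rw [coe_upwind, one_mul, hJ] at h2
  have h3 : derivative (x : ℂ[X]) = 0 := by simpa using h2
  exact ⟨_, eq_C_of_natDegree_eq_zero (derivative_eq_zero.1 h3)⟩

/-! ### The Padé property -/

/-- Adding a multiple of the Radau polynomial to the mode gives `H` with end-point values `f(z,1)`
and `g(z)`, for which `H' - (z/2) H` is a multiple of `z^{p+2} R`. Multiply by the integrating
factor `e^{-zξ/2}` and integrate. -/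
theorem padeError_eq (p : ℕ) (z : ℂ) :
    gPoly p z - Complex.exp (-z) * fPoly p z 1 =
      Complex.exp (-z / 2) * ((-1) ^ (p + 1) / 4 * z ^ (p + 2)) *
        ∫ ξ in (-1 : ℝ)..1, (radau p).eval (ξ : ℂ) * Complex.exp (-z / 2 * ξ) := by
  set H : ℂ[X] := (mode p z : ℂ[X]) + ((-1) ^ (p + 1) / 2 * z ^ (p + 1)) • radau p with hH
  have hs : ((-1 : ℂ) ^ (p + 1)) ^ 2 = 1 := by rw [← pow_mul, mul_comm, pow_mul]; simp
  have h1 : H.eval 1 = fPoly p z 1 := by simp [hH, eval_mode, radau_eval_one]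
  have h2 : H.eval (-1) = gPoly p z := by
    simp only [hH, eval_add, eval_mode, eval_smul, radau_eval_neg_one, smul_eq_mul, gPoly]
    linear_combination z ^ (p + 1) * hs
  have h3 : ∀ ξ : ℂ, (derivative H).eval ξ - z / 2 * H.eval ξ =
      -((-1) ^ (p + 1) / 4 * z ^ (p + 2)) * (radau p).eval ξ := by
    intro ξ
    have := congrArg (eval ξ) (smul_mode_sub p z)
    simp only [eval_sub, eval_smul, smul_eq_mul] at this
    simp only [hH, derivative_add, derivative_smul, eval_add, eval_smul, smul_eq_mul]
    linear_combination (-1 / 2 : ℂ) * this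
  have hd : ∀ x : ℝ, HasDerivAt (fun ξ : ℝ => H.eval (ξ : ℂ) * Complex.exp (-z / 2 * ξ))
      (-((-1) ^ (p + 1) / 4 * z ^ (p + 2)) *
        ((radau p).eval (x : ℂ) * Complex.exp (-z / 2 * x))) x := by
    intro x
    have e := (((hasDerivAt_id (x : ℂ)).const_mul (-z / 2)).cexp).comp_ofReal
    refine ((hasDerivAt_eval_ofReal H x).mul e).congr_deriv ?_
    simp only [id]
    linear_combination Complex.exp (-z / 2 * x) * h3 x
  have hc : Continuous fun x : ℝ => -((-1) ^ (p + 1) / 4 * z ^ (p + 2)) *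
        ((radau p).eval (x : ℂ) * Complex.exp (-z / 2 * x)) := by
    have := continuous_eval_ofReal (radau p)
    fun_prop
  have hibp := intervalIntegral.integral_eq_sub_of_hasDerivAt (a := -1) (b := 1)
    (fun x _ => hd x) (hc.intervalIntegrable _ _)
  rw [intervalIntegral.integral_const_mul] at hibp
  simp only [Complex.ofReal_one, Complex.ofReal_neg, h1, h2, mul_one] at hibp
  have e1 : Complex.exp (-z) = Complex.exp (-z / 2) * Complex.exp (-z / 2) := by
    rw [← Complex.exp_add]; ring_nf
  have e2 : Complex.exp (-z / 2) * Complex.exp (-z / 2 * -1) = 1 := by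
    rw [← Complex.exp_add]; ring_nf; simp
  rw [e1]
  linear_combination Complex.exp (-z / 2) * hibp - gPoly p z * e2

theorem exists_norm_integral_radau_mul_exp_le (p : ℕ) : ∃ c : ℝ, 0 ≤ c ∧ ∀ z : ℂ, ‖z‖ ≤ 1 →
    ‖∫ ξ in (-1 : ℝ)..1, (radau p).eval (ξ : ℂ) * Complex.exp (z * ξ)‖ ≤ c * ‖z‖ ^ p := by
  obtain ⟨b, hb⟩ := (isCompact_Icc (a := (-1 : ℝ)) (b := 1)).exists_bound_of_continuousOn
    (continuous_eval_ofReal (radau p)).continuousOn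
  have hb0 : 0 ≤ b := (norm_nonneg _).trans (hb 0 (by simp))
  refine ⟨b * Real.exp 1 * 2, by positivity, fun z hz => ?_⟩
  -- The Taylor polynomial of the exponential of degree below `p`: the Radau polynomial is
  -- orthogonal to it, so only the remainder of order `p` contributes.
  let T : ℂ[X] := ∑ m ∈ Finset.range p, C (z ^ m / m.factorial) * X ^ m
  have hT : T.degree < p := by
    refine (degree_sum_le _ _).trans_lt ((Finset.sup_lt_iff (WithBot.bot_lt_coe p)).2 ?_)
    intro m hm
    exact (degree_C_mul_X_pow_le _ _).trans_lt (WithBot.coe_lt_coe.2 (by simpa using hm))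
  have hTe : ∀ ξ : ℝ, T.eval (ξ : ℂ) = ∑ m ∈ Finset.range p, (z * ξ) ^ m / m.factorial := by
    intro ξ
    simp only [T, eval_finsetSum, eval_mul, eval_C, eval_pow, eval_X]
    exact Finset.sum_congr rfl fun m _ => by rw [mul_pow]; ring
  have h0 := cellIntegral_radau_mul_eq_zero p T hT
  rw [cellIntegral_mul] at h0
  have hR := continuous_eval_ofReal (radau p)
  have e : ∫ ξ in (-1 : ℝ)..1, (radau p).eval (ξ : ℂ) * Complex.exp (z * ξ) =
      ∫ ξ in (-1 : ℝ)..1, (radau p).eval (ξ : ℂ) * (Complex.exp (z * ξ) - T.eval (ξ : ℂ)) := by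
    have hT' := continuous_eval_ofReal T
    simp only [mul_sub]
    rw [intervalIntegral.integral_sub, h0, sub_zero]
    · exact Continuous.intervalIntegrable (by fun_prop) _ _
    · exact Continuous.intervalIntegrable (by fun_prop) _ _
  rw [e]
  have := intervalIntegral.norm_integral_le_of_norm_le_const (a := (-1 : ℝ)) (b := 1)
    (f := fun ξ : ℝ => (radau p).eval (ξ : ℂ) * (Complex.exp (z * ξ) - T.eval (ξ : ℂ)))
    (C := b * (‖z‖ ^ p * Real.exp 1)) (fun ξ hξ => by
      rw [Set.uIoc_of_le (by norm_num)] at hξ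
      have hξ' : ξ ∈ Set.Icc (-1 : ℝ) 1 := ⟨hξ.1.le, hξ.2⟩
      have hn : ‖z * ξ‖ ≤ ‖z‖ := by
        rw [norm_mul, Complex.norm_real]
        exact mul_le_of_le_one_right (norm_nonneg _) (abs_le.2 hξ')
      rw [norm_mul, hTe]
      refine mul_le_mul (hb ξ hξ') ?_ (norm_nonneg _) hb0
      refine (Complex.norm_exp_sub_sum_le_norm_mul_exp _ _).trans ?_
      gcongr
      exact hn.trans hz)
  refine this.trans_eq ?_
  norm_num
  ring

theorem exists_norm_padeError_le (p : ℕ) : ∃ c : ℝ, 0 ≤ c ∧ ∀ z : ℂ, ‖z‖ ≤ 1 →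
    ‖gPoly p z - Complex.exp (-z) * fPoly p z 1‖ ≤ c * ‖z‖ ^ (2 * p + 2) := by
  obtain ⟨c, hc, h⟩ := exists_norm_integral_radau_mul_exp_le p
  refine ⟨Real.exp 1 * c, by positivity, fun z hz => ?_⟩
  have hz2 : ‖-z / 2‖ ≤ ‖z‖ := by
    rw [norm_div, norm_neg, Complex.norm_ofNat]; linarith [norm_nonneg z]
  rw [padeError_eq, norm_mul, norm_mul]
  have h1 : ‖Complex.exp (-z / 2)‖ ≤ Real.exp 1 :=
    (Complex.norm_exp_le_exp_norm _).trans (Real.exp_le_exp.2 (hz2.trans hz))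
  have h2 : ‖(-1 : ℂ) ^ (p + 1) / 4 * z ^ (p + 2)‖ ≤ ‖z‖ ^ (p + 2) := by
    rw [norm_mul, norm_div, norm_pow, norm_pow, norm_neg, norm_one, one_pow]
    exact mul_le_of_le_one_left (by positivity) (by norm_num)
  have h3 : ‖∫ ξ in (-1 : ℝ)..1, (radau p).eval (ξ : ℂ) * Complex.exp (-z / 2 * ξ)‖ ≤
      c * ‖z‖ ^ p := (h _ (hz2.trans hz)).trans (by gcongr)
  calc _ ≤ Real.exp 1 * ‖z‖ ^ (p + 2) * (c * ‖z‖ ^ p) := by gcongr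
    _ = _ := by ring

/-! ### Operator semigroups in finite dimension -/

section Flow

open Filter Topology

variable {V : Type*} [NormedAddCommGroup V] [InnerProductSpace ℂ V] [CompleteSpace V]

/-- The semigroup `e^{τ T}`. -/
def flow (T : V →L[ℂ] V) (τ : ℝ) : V →L[ℂ] V := NormedSpace.exp ((τ : ℂ) • T)

theorem flow_zero (T : V →L[ℂ] V) : flow T 0 = 1 := by
  simp [flow, NormedSpace.exp_zero]

theorem flow_add (T : V →L[ℂ] V) (σ τ : ℝ) : flow T (σ + τ) = flow T σ * flow T τ := by
  let +nondep : NormedAlgebra ℚ (V →L[ℂ] V) := .restrictScalars ℚ ℂ _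
  rw [flow, flow, flow, ← NormedSpace.exp_add_of_commute, ← add_smul, Complex.ofReal_add]
  exact ((Commute.refl T).smul_left _).smul_right _

theorem flow_add_apply (T : V →L[ℂ] V) (σ τ : ℝ) (x : V) :
    flow T (σ + τ) x = flow T σ (flow T τ x) := by
  rw [flow_add]; rfl

theorem flow_nat_mul (T : V →L[ℂ] V) (n : ℕ) (τ : ℝ) : flow T (n * τ) = flow T τ ^ n := by
  induction n with
  | zero => simp [flow_zero]
  | succ n ih => rw [Nat.cast_succ, add_mul, one_mul, flow_add, ih, pow_succ]

theorem flow_apply_comm (T : V →L[ℂ] V) (τ : ℝ) (x : V) : flow T τ (T x) = T (flow T τ x) := by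
  have h : Commute (flow T τ) T := (((Commute.refl T).smul_left (τ : ℂ))).exp_left
  exact congrArg (fun S : V →L[ℂ] V => S x) h.eq

theorem hasDerivAt_flow (T : V →L[ℂ] V) (τ : ℝ) : HasDerivAt (flow T) (T * flow T τ) τ := by
  have := (hasDerivAt_exp_smul_const' T (τ : ℂ)).scomp τ Complex.ofRealCLM.hasDerivAt
  exact this.congr_deriv (by rw [Complex.ofRealCLM_apply, Complex.ofReal_one, one_smul]; rfl)

theorem hasDerivAt_flow_apply (T : V →L[ℂ] V) (x : V) (τ : ℝ) :
    HasDerivAt (fun σ => flow T σ x) (T (flow T τ x)) τ := by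
  have := ((ContinuousLinearMap.apply ℂ V x).restrictScalars ℝ).hasFDerivAt.comp_hasDerivAt τ
    (hasDerivAt_flow T τ)
  exact this

theorem norm_flow_le (T : V →L[ℂ] V) (τ : ℝ) : ‖flow T τ‖ ≤ Real.exp (|τ| * ‖T‖) := by
  have h1 := NormedSpace.exp_series_hasSum_exp' (𝕂 := ℂ) ((τ : ℂ) • T)
  have h2 := NormedSpace.exp_series_hasSum_exp' (𝕂 := ℝ) (|τ| * ‖T‖)
  rw [← Real.exp_eq_exp_ℝ] at h2
  refine h1.norm_le_of_bounded h2 fun n => ?_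
  rw [norm_smul, norm_inv, RCLike.norm_natCast, smul_eq_mul]
  gcongr
  have h3 : ‖(τ : ℂ) • T‖ = |τ| * ‖T‖ := by rw [norm_smul, Complex.norm_real, Real.norm_eq_abs]
  rw [← h3]
  rcases Nat.eq_zero_or_pos n with rfl | hn
  · simpa using! ContinuousLinearMap.norm_id_le (𝕜 := ℂ) (E := V)
  · exact norm_pow_le' _ hn

theorem norm_flow_apply_le_of_dissipative {T : V →L[ℂ] V}
    (hT : ∀ x, (inner ℂ x (T x)).re ≤ 0) {τ : ℝ} (hτ : 0 ≤ τ) (x : V) :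
    ‖flow T τ x‖ ≤ ‖x‖ := by
  have hd : ∀ σ : ℝ, HasDerivAt (fun σ => ‖flow T σ x‖ ^ 2)
      (2 * (inner ℂ (flow T σ x) (T (flow T σ x))).re) σ := by
    intro σ
    have h1 := (hasDerivAt_flow_apply T x σ).inner ℂ (hasDerivAt_flow_apply T x σ)
    have h2 := Complex.reCLM.hasFDerivAt.comp_hasDerivAt σ h1
    refine (h2.congr_deriv ?_).congr_of_eventuallyEq (Eventually.of_forall fun s => ?_)
    · rw [map_add, Complex.reCLM_apply, Complex.reCLM_apply, ← inner_conj_symm (T (flow T σ x)),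
        Complex.conj_re]
      ring
    · have := inner_self_eq_norm_sq (𝕜 := ℂ) (flow T s x)
      simpa using this.symm
  have hanti : Antitone fun σ => ‖flow T σ x‖ ^ 2 :=
    antitone_of_deriv_nonpos (fun σ => (hd σ).differentiableAt) fun σ => by
      rw [(hd σ).deriv]; linarith [hT (flow T σ x)]
  have := hanti hτ
  simp only [flow_zero, one_apply_eq_self] at this
  exact (pow_le_pow_iff_left₀ (norm_nonneg _) (norm_nonneg _) two_ne_zero).1 this

theorem flow_apply_eigenvector {T : V →L[ℂ] V} {c : ℂ} {x : V} (h : T x = c • x) (τ : ℝ) :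
    flow T τ x = Complex.exp (τ * c) • x := by
  have h1 := NormedSpace.exp_series_hasSum_exp' (𝕂 := ℂ) ((τ : ℂ) • T)
  have h2 := (NormedSpace.exp_series_hasSum_exp' (𝕂 := ℂ) (τ * c)).smul_const x
  rw [← Complex.exp_eq_exp_ℂ] at h2
  have h3 := (ContinuousLinearMap.apply ℂ V x).hasSum h1
  refine h3.unique (h2.congr_fun fun n => ?_)
  have hn : ∀ n : ℕ, (((τ : ℂ) • T) ^ n) x = (τ * c) ^ n • x := by
    intro n
    induction n with
    | zero => simp
    | succ n ih =>
      rw [pow_succ', mul_apply_eq_comp, ih, map_smul, smul_apply, h, smul_smul,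
        smul_smul, pow_succ, mul_assoc]
  rw [ContinuousLinearMap.apply_apply, smul_apply, hn, smul_assoc]

/-- Duhamel's formula: `F` interpolates between the two flows, its derivative is the perturbation
transported by the contraction `flow G`, and `d / ν` bounds the integral of `d e^{-νσ}`. -/
theorem norm_flow_sub_flow_le {G T : V →L[ℂ] V} (hG : ∀ x, (inner ℂ x (G x)).re ≤ 0) {x : V}
    {ν d : ℝ} (hν : 0 < ν) (hd : ∀ σ, 0 ≤ σ → ‖(T - G) (flow T σ x)‖ ≤ d * Real.exp (-(ν * σ)))
    {τ : ℝ} (hτ : 0 ≤ τ) : ‖flow T τ x - flow G τ x‖ ≤ d / ν := by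
  have hd0 : 0 ≤ d := by simpa using (norm_nonneg _).trans (hd 0 le_rfl)
  let F : ℝ → V := fun σ => flow G (τ - σ) (flow T σ x)
  have hF : ∀ σ, HasDerivAt F (flow G (τ - σ) ((T - G) (flow T σ x))) σ := by
    intro σ
    have h1 : HasDerivAt (fun σ => flow G (τ - σ)) (-(G * flow G (τ - σ))) σ :=
      (hasDerivAt_flow G (τ - σ)).comp_const_sub τ σ
    have h2 := hasDerivAt_flow_apply T x σ
    have h4 := (isBoundedBilinearMap_apply (𝕜 := ℂ) (E := V) (F := V)).hasFDerivAt
      (flow G (τ - σ), flow T σ x)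
    have h5 := (h4.restrictScalars ℝ).comp_hasDerivAt σ (h1.prodMk h2)
    refine h5.congr_deriv ?_
    simp [flow_apply_comm, sub_eq_add_neg]
  let B : ℝ → ℝ := fun σ => d / ν - d / ν * Real.exp (-(ν * σ))
  have hB : ∀ σ, HasDerivAt B (d * Real.exp (-(ν * σ))) σ := by
    intro σ
    have h1 : HasDerivAt (fun σ => Real.exp (-(ν * σ))) (Real.exp (-(ν * σ)) * -(ν * 1)) σ :=
      (((hasDerivAt_id σ).const_mul ν).neg).exp
    refine ((h1.const_mul (d / ν)).const_sub (d / ν)).congr_deriv ?_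
    field_simp
  have h := image_norm_le_of_norm_deriv_right_le_deriv_boundary (a := 0) (b := τ)
    (f := fun σ => F σ - F 0) (f' := fun σ => flow G (τ - σ) ((T - G) (flow T σ x)))
    (fun σ _ => ((hF σ).sub_const _).continuousAt.continuousWithinAt)
    (fun σ _ => ((hF σ).sub_const _).hasDerivWithinAt) (B := B) (by simp [B]) hB
    (fun σ hσ => (norm_flow_apply_le_of_dissipative hG (by linarith [hσ.2]) _).trans
      (hd σ hσ.1)) (Set.right_mem_Icc.2 hτ)
  simp only [F, sub_self, flow_zero, sub_zero, one_apply_eq_self] at h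
  refine h.trans ?_
  simp only [B]
  have : 0 ≤ d / ν * Real.exp (-(ν * τ)) := by positivity
  linarith

/-- The derivative of `e^{iθσ} e^{σG} x` is the residual `G x + iθ x`, transported by a contraction
for unit time. -/
theorem norm_exp_smul_flow_sub_le {G : V →L[ℂ] V} (hG : ∀ x, (inner ℂ x (G x)).re ≤ 0)
    (θ : ℝ) (x : V) : ‖Complex.exp (θ * Complex.I) • flow G 1 x - x‖ ≤
      ‖G x + (θ * Complex.I) • x‖ := by
  have hF : ∀ σ : ℝ, HasDerivAt (fun σ : ℝ => Complex.exp (θ * Complex.I * σ) • flow G σ x)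
      (Complex.exp (θ * Complex.I * σ) • flow G σ (G x + (θ * Complex.I) • x)) σ := by
    intro σ
    have h1 : HasDerivAt (fun σ : ℝ => Complex.exp (θ * Complex.I * σ)) _ σ :=
      (((hasDerivAt_id (σ : ℂ)).const_mul (θ * Complex.I)).cexp).comp_ofReal
    refine (h1.smul (hasDerivAt_flow_apply G x σ)).congr_deriv ?_
    rw [map_add, map_smul, flow_apply_comm]
    simp only [id]
    module
  have := norm_image_sub_le_of_norm_deriv_le_segment_01' (fun σ _ => (hF σ).hasDerivWithinAt)
    (C := ‖G x + (θ * Complex.I) • x‖) (fun σ hσ => by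
      rw [norm_smul, show (θ : ℂ) * Complex.I * σ = ((θ * σ : ℝ) : ℂ) * Complex.I by
        push_cast; ring, Complex.norm_exp_ofReal_mul_I, one_mul]
      exact norm_flow_apply_le_of_dissipative hG hσ.1 _)
  simpa [flow_zero] using this

theorem apply_flow_eq_zero {T : V →L[ℂ] V} {l : V →L[ℂ] ℂ} {c : ℂ} (hl : ∀ x, l (T x) = c * l x)
    {x : V} (hx : l x = 0) (τ : ℝ) : l (flow T τ x) = 0 := by
  have hF : ∀ σ : ℝ, HasDerivAt (fun σ : ℝ => Complex.exp (-c * σ) * l (flow T σ x)) 0 σ := by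
    intro σ
    have h1 : HasDerivAt (fun σ : ℝ => Complex.exp (-c * σ)) _ σ :=
      (((hasDerivAt_id (σ : ℂ)).const_mul (-c)).cexp).comp_ofReal
    have h2 := (l.restrictScalars ℝ).hasFDerivAt.comp_hasDerivAt σ (hasDerivAt_flow_apply T x σ)
    refine (h1.mul h2).congr_deriv ?_
    simp [hl]
    ring
  have := is_const_of_deriv_eq_zero (fun σ => (hF σ).differentiableAt) (fun σ => (hF σ).deriv) τ 0
  simpa [flow_zero, hx, Complex.exp_ne_zero] using this

variable [FiniteDimensional ℂ V]

/-- An eigenspace of `e^T` is invariant under `T`, hence contains an eigenvector of `T`; so every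
eigenvalue of `e^T` is the exponential of one of `T`. -/
theorem spectralRadius_flow_one_le {T : V →L[ℂ] V} {μ : ℝ}
    (hT : ∀ (c : ℂ) (x : V), x ≠ 0 → T x = c • x → c.re ≤ -μ) :
    spectralRadius ℂ (flow T 1) ≤ ENNReal.ofReal (Real.exp (-μ)) := by
  refine iSup₂_le fun k hk => ?_
  let S : Module.End ℂ V := (flow T 1 : V →L[ℂ] V)
  have hS : Module.End.toContinuousLinearMap V S = flow T 1 := by ext; rfl
  rw [← hS, AlgEquiv.spectrum_eq, ← Module.End.hasEigenvalue_iff_mem_spectrum] at hk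
  let E := Module.End.eigenspace S k
  have hE : ∀ x ∈ E, (T : V →ₗ[ℂ] V) x ∈ E := by
    intro x hx
    rw [Module.End.mem_eigenspace_iff] at hx ⊢
    have hx' : flow T 1 x = k • x := hx
    change flow T 1 (T x) = k • T x
    rw [flow_apply_comm, hx', map_smul]
  have : Nontrivial E := Submodule.nontrivial_iff_ne_bot.2 hk
  obtain ⟨c, hc⟩ := Module.End.exists_eigenvalue ((T : V →ₗ[ℂ] V).restrict hE)
  obtain ⟨⟨x, hxE⟩, hx⟩ := hc.exists_hasEigenvector
  have hx0 : x ≠ 0 := fun h => hx.2 (Subtype.ext h)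
  have hTx : T x = c • x := congrArg Subtype.val hx.apply_eq_smul
  have h1 := flow_apply_eigenvector hTx 1
  have h2 : flow T 1 x = k • x := Module.End.mem_eigenspace_iff.1 hxE
  rw [h2] at h1
  have hk : k = Complex.exp c := by simpa using smul_left_injective ℂ hx0 h1
  rw [← enorm_eq_nnnorm, ← ofReal_norm, hk, Complex.norm_exp]
  exact ENNReal.ofReal_le_ofReal (Real.exp_le_exp.2 (hT c x hx0 hTx))

/-- Exponential decay, uniformly for operators near `T`. -/
theorem exists_eventually_norm_flow_le {T : V →L[ℂ] V} {μ ν : ℝ} (hν : ν < μ) (hν0 : 0 ≤ ν)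
    (hT : ∀ (c : ℂ) (x : V), x ≠ 0 → T x = c • x → c.re ≤ -μ) :
    ∃ C : ℝ, 0 ≤ C ∧ ∀ᶠ S in 𝓝 T, ∀ τ : ℝ, 0 ≤ τ → ‖flow S τ‖ ≤ C * Real.exp (-(ν * τ)) := by
  have hlt : spectralRadius ℂ (flow T 1) < ENNReal.ofReal (Real.exp (-ν)) :=
    (spectralRadius_flow_one_le hT).trans_lt
      ((ENNReal.ofReal_lt_ofReal_iff (Real.exp_pos _)).2 (Real.exp_lt_exp.2 (by linarith)))
  -- Gelfand's formula gives a single time `n` with `‖e^{nT}‖ < e^{-νn}`. This strict inequality is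
  -- open in the operator, which is the source of the uniformity; longer times follow by taking
  -- powers.
  obtain ⟨n, hn, hn1⟩ := (((spectrum.pow_norm_pow_one_div_tendsto_nhds_spectralRadius
    (flow T 1)).eventually_lt_const hlt).and (eventually_ge_atTop 1)).exists
  have hn0 : (0 : ℝ) < n := by exact_mod_cast hn1
  rw [ENNReal.ofReal_lt_ofReal_iff (Real.exp_pos _)] at hn
  have hpow : ‖flow T n‖ < Real.exp (-(ν * n)) := by
    have h1 := Real.rpow_lt_rpow (by positivity) hn hn0
    rw [← Real.rpow_mul (norm_nonneg _), one_div_mul_cancel hn0.ne', Real.rpow_one,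
      ← Real.exp_mul, ← flow_nat_mul, mul_one] at h1
    simpa using h1
  have hcont : Continuous fun S : V →L[ℂ] V => ‖flow S n‖ := by
    let +nondep : NormedAlgebra ℚ (V →L[ℂ] V) := .restrictScalars ℚ ℂ _
    unfold flow
    exact (NormedSpace.exp_continuous.comp (continuous_const_smul _)).norm
  have hev : ∀ᶠ S in 𝓝 T, ‖flow S n‖ < Real.exp (-(ν * n)) :=
    hcont.continuousAt.eventually_lt_const hpow
  have hev2 : ∀ᶠ S in 𝓝 T, ‖S‖ < ‖T‖ + 1 :=
    continuous_norm.continuousAt.eventually_lt_const (by simp)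
  refine ⟨Real.exp (n * (‖T‖ + 1)) * Real.exp (ν * n), by positivity, ?_⟩
  filter_upwards [hev, hev2] with S h1 h2 τ hτ
  set m := ⌊τ / n⌋₊
  have hm : m * n ≤ τ := by
    have := Nat.floor_le (div_nonneg hτ hn0.le)
    rwa [le_div_iff₀ hn0] at this
  have hm' : τ < (m + 1) * n := by
    have := Nat.lt_floor_add_one (τ / n)
    rwa [div_lt_iff₀ hn0] at this
  have e : flow S τ = flow S (τ - m * n) * flow S n ^ m := by
    rw [← flow_nat_mul, ← flow_add, sub_add_cancel]
  have h3 : ‖flow S (τ - m * n)‖ ≤ Real.exp (n * (‖T‖ + 1)) := by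
    refine (norm_flow_le S _).trans (Real.exp_le_exp.2 ?_)
    rw [abs_of_nonneg (by linarith)]
    exact mul_le_mul (by linarith) h2.le (norm_nonneg _) hn0.le
  have h4 : ‖flow S n ^ m‖ ≤ Real.exp (-(ν * n)) ^ m := by
    rcases Nat.eq_zero_or_pos m with h0 | h0
    · rw [h0]
      simpa using! ContinuousLinearMap.norm_id_le (𝕜 := ℂ) (E := V)
    · exact (norm_pow_le' _ h0).trans (by gcongr)
  rw [e]
  refine (norm_mul_le _ _).trans ?_
  rw [mul_assoc, ← Real.exp_add]
  refine mul_le_mul h3 (h4.trans ?_) (norm_nonneg _) (by positivity)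
  rw [← Real.exp_nat_mul]
  refine Real.exp_le_exp.2 ?_
  nlinarith

end Flow

/-! ### Approximate eigenvectors and damping of the complementary modes -/

section ModeBound

open Filter Topology

variable {V : Type*} [NormedAddCommGroup V] [InnerProductSpace ℂ V]

/-- The operator `G`, modified on the span of `v` so that the functional `b v` is damped. -/
def dampedOp (b : V →L[ℂ] V →L[ℂ] ℂ) (μ : ℝ) (G : V →L[ℂ] V) (v : V) : V →L[ℂ] V :=
  G - (b v v)⁻¹ • ((b v).comp G + (μ : ℂ) • b v).smulRight v

theorem dampedOp_apply (b : V →L[ℂ] V →L[ℂ] ℂ) (μ : ℝ) (G : V →L[ℂ] V) (v x : V) :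
    dampedOp b μ G v x = G x - ((b v v)⁻¹ * (b v (G x) + μ * b v x)) • v := by
  simp [dampedOp, smul_smul]

theorem apply_dampedOp {b : V →L[ℂ] V →L[ℂ] ℂ} {v : V} (hv : b v v ≠ 0) (μ : ℝ)
    (G : V →L[ℂ] V) (x : V) : b v (dampedOp b μ G v x) = -μ * b v x := by
  rw [dampedOp_apply, map_sub, map_smul, smul_eq_mul]
  field_simp
  ring

/-- Pairing an eigenvector with `v` gives `(c + μ) b v x = 0`. Either `c = -μ`, or `b v x = 0` and
`x` is an eigenvector of `G` itself, whose eigenvalue is non-zero by `hker`. -/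
theorem dampedOp_eigenvalue_re_le {b : V →L[ℂ] V →L[ℂ] ℂ} {v : V} (hv : b v v ≠ 0) {μ : ℝ}
    {G : V →L[ℂ] V} (hsymm : ∀ x y, b (G x) y = b x (G y)) (hG : G v = 0)
    (hker : ∀ x, G x = 0 → b v x = 0 → x = 0)
    (hspec : ∀ (c : ℂ) (x : V), x ≠ 0 → c ≠ 0 → G x = c • x → c.re ≤ -μ)
    (c : ℂ) (x : V) (hx : x ≠ 0) (h : dampedOp b μ G v x = c • x) : c.re ≤ -μ := by
  have h1 : b v (G x) = 0 := by rw [← hsymm, hG]; simp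
  have h2 := apply_dampedOp hv μ G x
  rw [h, map_smul, smul_eq_mul] at h2
  by_cases h0 : b v x = 0
  · rw [dampedOp_apply, h1, h0] at h
    simp only [mul_zero, add_zero, zero_smul, sub_zero] at h
    refine hspec c x hx (fun hc => hx (hker x ?_ h0)) h
    rw [h, hc, zero_smul]
  · rw [mul_right_cancel₀ h0 h2]
    simp

/-- The component of `x` along `u` removed, as measured by the form `b`. -/
def formProj (b : V →L[ℂ] V →L[ℂ] ℂ) (u x : V) : V := x - ((b u u)⁻¹ * b u x) • u

theorem apply_formProj {b : V →L[ℂ] V →L[ℂ] ℂ} {u : V} (hu : b u u ≠ 0) (x : V) :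
    b u (formProj b u x) = 0 := by
  rw [formProj, map_sub, map_smul, smul_eq_mul]
  field_simp
  ring

theorem norm_formProj_le (b : V →L[ℂ] V →L[ℂ] ℂ) {u : V} {c₁ c₂ : ℝ} (h1 : ‖u‖ ≤ c₁)
    (h2 : ‖(b u u)⁻¹‖ ≤ c₂) (x : V) : ‖formProj b u x‖ ≤ (1 + c₂ * (‖b‖ * c₁) * c₁) * ‖x‖ := by
  have hc1 : 0 ≤ c₁ := (norm_nonneg _).trans h1
  have hc2 : 0 ≤ c₂ := (norm_nonneg _).trans h2
  have e : ‖((b u u)⁻¹ * b u x) • u‖ ≤ c₂ * (‖b‖ * c₁) * c₁ * ‖x‖ := by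
    rw [norm_smul, norm_mul]
    calc ‖(b u u)⁻¹‖ * ‖b u x‖ * ‖u‖ ≤ c₂ * (‖b‖ * c₁ * ‖x‖) * c₁ := by
          gcongr
          exact (b.le_opNorm₂ _ _).trans (by gcongr)
      _ = _ := by ring
  calc _ ≤ ‖x‖ + c₂ * (‖b‖ * c₁) * c₁ * ‖x‖ := (norm_sub_le _ _).trans (by gcongr)
    _ = _ := by ring

theorem norm_formProj_le_of_near {b : V →L[ℂ] V →L[ℂ] ℂ} {u u₀ : V} (hu : b u u ≠ 0)
    (hu₀ : u₀ ≠ 0) {c k r : ℝ} (hc : ∀ y, ‖formProj b u y‖ ≤ c * ‖y‖) (hc0 : 0 ≤ c) (hk : 0 ≤ k)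
    (hr : 0 ≤ r) (hr1 : r ≤ 1) (hd : ‖u - u₀‖ ≤ k * r) (x : V) (s : ℂ) :
    ‖formProj b u x‖ ≤ c * (1 + k * ‖u₀‖⁻¹) * (‖x - s • u₀‖ + r * ‖x‖) := by
  have hv0' : 0 < ‖u₀‖ := norm_pos_iff.2 hu₀
  -- The projection kills `u`, so it sees `u₀` only through `u₀ - u`.
  have e : formProj b u x = formProj b u (x - s • u₀) - s • formProj b u (u - u₀) := by
    simp only [formProj, map_sub, map_smul, smul_eq_mul, mul_sub, inv_mul_cancel₀ hu]
    module
  have hs : ‖s‖ * ‖u₀‖ ≤ ‖x‖ + ‖x - s • u₀‖ := by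
    rw [← norm_smul]
    calc ‖s • u₀‖ = ‖x - (x - s • u₀)‖ := by congr 1; abel
      _ ≤ _ := norm_sub_le _ _
  have hs' : ‖s‖ ≤ ‖u₀‖⁻¹ * (‖x‖ + ‖x - s • u₀‖) := by
    rw [inv_mul_eq_div, le_div_iff₀ hv0']; exact hs
  have hb1 : ‖s • formProj b u (u - u₀)‖ ≤ c * k * ‖u₀‖⁻¹ * (‖x - s • u₀‖ + r * ‖x‖) := by
    rw [norm_smul]
    calc ‖s‖ * ‖formProj b u (u - u₀)‖
        ≤ (‖u₀‖⁻¹ * (‖x‖ + ‖x - s • u₀‖)) * (c * (k * r)) := by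
          gcongr
          exact (hc _).trans (by gcongr)
      _ = c * k * ‖u₀‖⁻¹ * (r * ‖x - s • u₀‖ + r * ‖x‖) := by ring
      _ ≤ c * k * ‖u₀‖⁻¹ * (1 * ‖x - s • u₀‖ + r * ‖x‖) := by gcongr
      _ = _ := by ring
  rw [e]
  have hp : 0 ≤ r * ‖x‖ := by positivity
  calc _ ≤ c * ‖x - s • u₀‖ + c * k * ‖u₀‖⁻¹ * (‖x - s • u₀‖ + r * ‖x‖) :=
        (norm_sub_le _ _).trans (add_le_add (hc _) hb1)
    _ ≤ c * (‖x - s • u₀‖ + r * ‖x‖) + c * k * ‖u₀‖⁻¹ * (‖x - s • u₀‖ + r * ‖x‖) := by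
        gcongr
        linarith
    _ = _ := by ring

variable [CompleteSpace V]

/-- Decay of the part of `x` that is annihilated by the approximate left eigenvector `b v`. -/
theorem norm_flow_apply_le_of_apply_eq_zero {b : V →L[ℂ] V →L[ℂ] ℂ} {v : V} (hv : b v v ≠ 0)
    {μ ν : ℝ} (hν : 0 < ν) {G : V →L[ℂ] V} (hsymm : ∀ x y, b (G x) y = b x (G y))
    (hG : ∀ x, (inner ℂ x (G x)).re ≤ 0) {c : ℝ}
    (hflow : ∀ τ : ℝ, 0 ≤ τ → ‖flow (dampedOp b μ G v) τ‖ ≤ c * Real.exp (-(ν * τ)))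
    (z : ℂ) {x : V} (hx : b v x = 0) {τ : ℝ} (hτ : 0 ≤ τ) :
    ‖flow G τ x‖ ≤ c * Real.exp (-(ν * τ)) * ‖x‖ +
      ‖(b v v)⁻¹‖ * (‖b‖ * ‖G v + z • v‖) * ‖v‖ * c * ‖x‖ / ν := by
  set T := dampedOp b μ G v with hT
  have hb : ∀ σ, b v (flow T σ x) = 0 := fun σ => apply_flow_eq_zero (apply_dampedOp hv μ G) hx σ
  have hy : ∀ σ, 0 ≤ σ → ‖flow T σ x‖ ≤ c * Real.exp (-(ν * σ)) * ‖x‖ := fun σ hσ =>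
    ((flow T σ).le_opNorm x).trans (mul_le_mul_of_nonneg_right (hflow σ hσ) (norm_nonneg _))
  have h := norm_flow_sub_flow_le hG (T := T) (x := x) hν
    (d := ‖(b v v)⁻¹‖ * (‖b‖ * ‖G v + z • v‖) * ‖v‖ * c * ‖x‖) (fun σ hσ => by
      set y := flow T σ x
      -- Since `b v y = 0`, symmetry turns `b v (G y)` into `b (G v + z • v) y`, so the perturbation
      -- is as small as the residual of `v`.
      have e1 : (T - G) y = -(((b v v)⁻¹ * b (G v + z • v) y) • v) := by
        rw [sub_apply, hT, dampedOp_apply, hb σ, map_add, add_apply, map_smul, smul_apply, hb σ,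
          hsymm]
        simp
      rw [e1, norm_neg, norm_smul, norm_mul]
      have e2 : ‖b (G v + z • v) y‖ ≤ ‖b‖ * ‖G v + z • v‖ * (c * Real.exp (-(ν * σ)) * ‖x‖) :=
        (b.le_opNorm₂ _ _).trans (mul_le_mul_of_nonneg_left (hy σ hσ) (by positivity))
      calc _ ≤ ‖(b v v)⁻¹‖ * (‖b‖ * ‖G v + z • v‖ * (c * Real.exp (-(ν * σ)) * ‖x‖)) * ‖v‖ := by
            gcongr
        _ = _ := by ring) hτ
  have e3 : flow G τ x = flow T τ x - (flow T τ x - flow G τ x) := by abel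
  rw [e3]
  exact (norm_sub_le _ _).trans (add_le_add (hy τ hτ) h)

/-- Only the component along `u` produces the residual; for the complementary component the shifted
and unshifted terms are bounded separately, to be controlled later by decay. -/
theorem norm_flow_shift_le {b : V →L[ℂ] V →L[ℂ] ℂ} {u : V} {g : V →L[ℂ] V}
    (hg : ∀ x, (inner ℂ x (g x)).re ≤ 0) (θ : ℝ) {τ : ℝ} (hτ : 0 ≤ τ) (x : V) :
    ‖flow g τ (Complex.exp (θ * Complex.I) • flow g 1 x - x)‖ ≤
      ‖(b u u)⁻¹‖ * (‖b‖ * ‖u‖ * ‖x‖) * ‖g u + (θ * Complex.I) • u‖ +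
        2 * ‖flow g τ (formProj b u x)‖ := by
  set w := Complex.exp (θ * Complex.I) with hw
  have hw1 : ‖w‖ = 1 := Complex.norm_exp_ofReal_mul_I θ
  set y := formProj b u x with hy
  have ex : x = ((b u u)⁻¹ * b u x) • u + y := by rw [hy, formProj]; abel
  have esplit : flow g τ (w • flow g 1 x - x) =
      flow g τ (((b u u)⁻¹ * b u x) • (w • flow g 1 u - u)) +
        (w • flow g 1 (flow g τ y) - flow g τ y) := by
    have h1 : flow g 1 (flow g τ y) = flow g τ (flow g 1 y) := by
      rw [← flow_add_apply, add_comm, flow_add_apply]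
    have h2 : w • flow g 1 x - x =
        ((b u u)⁻¹ * b u x) • (w • flow g 1 u - u) + (w • flow g 1 y - y) := by
      generalize (b u u)⁻¹ * b u x = k at ex ⊢
      rw [ex, map_add, map_smul]
      module
    rw [h2, map_add, map_sub, map_smul, h1, map_smul]
  rw [esplit]
  refine (norm_add_le _ _).trans (add_le_add ?_ ?_)
  · refine (norm_flow_apply_le_of_dissipative hg hτ _).trans ?_
    rw [norm_smul, norm_mul]
    gcongr
    · exact b.le_opNorm₂ _ _
    · exact norm_exp_smul_flow_sub_le hg θ u
  · refine (norm_sub_le _ _).trans ?_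
    rw [norm_smul, hw1, one_mul, two_mul]
    gcongr
    exact norm_flow_apply_le_of_dissipative hg zero_le_one _

theorem continuousAt_dampedOp {G : ℝ → V →L[ℂ] V} {v : ℝ → V} {b : V →L[ℂ] V →L[ℂ] ℂ} (μ : ℝ)
    (hGc : ContinuousAt G 0) (hvc : ContinuousAt v 0) (hb : b (v 0) (v 0) ≠ 0) :
    ContinuousAt (fun θ => dampedOp b μ (G θ) (v θ)) 0 := by
  have hα : ContinuousAt (fun θ => b (v θ) (v θ)) 0 := by fun_prop
  have hbv : ContinuousAt (fun θ => b (v θ)) 0 := by fun_prop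
  have h1 : ContinuousAt (fun θ => (b (v θ)).comp (G θ) + (μ : ℂ) • b (v θ)) 0 :=
    (hbv.clm_comp hGc).add (hbv.const_smul (μ : ℂ))
  have h2 : ContinuousAt
      (fun θ => ((b (v θ)).comp (G θ) + (μ : ℂ) • b (v θ)).smulRight (v θ)) 0 :=
    ContinuousAt.comp (f := fun θ => ((b (v θ)).comp (G θ) + (μ : ℂ) • b (v θ), v θ))
      (ContinuousLinearMap.smulRightL ℂ V V).continuous₂.continuousAt (h1.prodMk hvc)
  exact hGc.sub ((hα.inv₀ hb).smul h2)

/-- Spectral information is needed only at θ = 0: continuity of the damped operator carries its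
decay to nearby θ. The vector `s • v 0` records how close `x` is to the limiting mode, so that the
decaying term gets a small prefactor. -/
theorem exists_eventually_norm_flow_shift_le [FiniteDimensional ℂ V] {G : ℝ → V →L[ℂ] V}
    {v : ℝ → V} {b : V →L[ℂ] V →L[ℂ] ℂ} {μ ν : ℝ} {q : ℕ} (hν : 0 < ν) (hνμ : ν < μ)
    (hGc : ContinuousAt G 0) (hG : ∀ θ x, (inner ℂ x (G θ x)).re ≤ 0)
    (hvc : ContinuousAt v 0) (hv : (fun θ => v θ - v 0) =O[𝓝 0] fun θ : ℝ => θ)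
    (hsymm : ∀ θ x y, b (G θ x) y = b x (G θ y))
    (hres : (fun θ : ℝ => G θ (v θ) + (θ * Complex.I) • v θ) =O[𝓝 0] fun θ : ℝ => θ ^ q)
    (hG0 : G 0 (v 0) = 0) (hb : b (v 0) (v 0) ≠ 0)
    (hker : ∀ x, G 0 x = 0 → b (v 0) x = 0 → x = 0)
    (hspec : ∀ (c : ℂ) (x : V), x ≠ 0 → c ≠ 0 → G 0 x = c • x → c.re ≤ -μ) :
    ∃ C : ℝ, 0 ≤ C ∧ ∀ᶠ θ : ℝ in 𝓝 0, ∀ τ : ℝ, 0 ≤ τ → ∀ (x : V) (s : ℂ),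
      ‖flow (G θ) τ (Complex.exp (θ * Complex.I) • flow (G θ) 1 x - x)‖ ≤
        C * (|θ| ^ q * ‖x‖) +
          C * (Real.exp (-(ν * τ)) * (‖x - s • v 0‖ + |θ| * ‖x‖)) := by
  have hv0 : v 0 ≠ 0 := fun h => hb (by simp [h])
  have hα : ContinuousAt (fun θ => b (v θ) (v θ)) 0 := by fun_prop
  have hαi : ContinuousAt (fun θ => (b (v θ) (v θ))⁻¹) 0 := hα.inv₀ hb
  have hTc := continuousAt_dampedOp μ hGc hvc hb
  obtain ⟨c5, hc5, hflow⟩ := exists_eventually_norm_flow_le hνμ hν.le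
    (dampedOp_eigenvalue_re_le hb (hsymm 0) hG0 hker hspec)
  obtain ⟨c3, hc3, hres⟩ := hres.exists_nonneg
  obtain ⟨c4, hc4, hv⟩ := hv.exists_nonneg
  obtain ⟨c1, hc1⟩ : ∃ c1, ‖v 0‖ < c1 := exists_gt _
  obtain ⟨c2, hc2⟩ : ∃ c2, ‖(b (v 0) (v 0))⁻¹‖ < c2 := exists_gt _
  have hc1' : 0 < c1 := (norm_nonneg _).trans_lt hc1
  have hc2' : 0 < c2 := (norm_nonneg _).trans_lt hc2
  obtain ⟨c6, hc6⟩ : ∃ c6, c6 = 1 + c2 * (‖b‖ * c1) * c1 := ⟨_, rfl⟩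
  have hc6' : 0 ≤ c6 := by rw [hc6]; positivity
  obtain ⟨c7, hc7⟩ : ∃ c7, c7 = c6 * (1 + c4 * ‖v 0‖⁻¹) := ⟨_, rfl⟩
  have hc7' : 0 ≤ c7 := by rw [hc7]; positivity
  have k1 : 0 ≤ c2 * (‖b‖ * c1) * c3 := by positivity
  have k2 : 0 ≤ c5 * c7 := by positivity
  have k3 : 0 ≤ c2 * (‖b‖ * c3) * c1 * c5 * c6 / ν := by positivity
  refine ⟨c2 * (‖b‖ * c1) * c3 + 2 * (c5 * c7) + 2 * (c2 * (‖b‖ * c3) * c1 * c5 * c6 / ν),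
    by positivity, ?_⟩
  filter_upwards [hTc.tendsto.eventually hflow, hres.bound, hv.bound,
    hvc.norm.eventually_lt_const hc1, hαi.norm.eventually_lt_const hc2,
    hα.eventually_ne hb, Metric.closedBall_mem_nhds (0 : ℝ) one_pos]
    with θ hfl hre hvθ h1 h2 hne hθ1 τ hτ x s
  rw [Real.norm_eq_abs] at hvθ
  rw [norm_pow, Real.norm_eq_abs] at hre
  rw [mem_closedBall_zero_iff, Real.norm_eq_abs] at hθ1
  have hR : ∀ y, ‖formProj b (v θ) y‖ ≤ c6 * ‖y‖ := fun y => by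
    rw [hc6]; exact norm_formProj_le b h1.le h2.le y
  have hx1 : ‖formProj b (v θ) x‖ ≤ c7 * (‖x - s • v 0‖ + |θ| * ‖x‖) := by
    rw [hc7]
    exact norm_formProj_le_of_near hne hv0 hR hc6' hc4 (abs_nonneg θ) hθ1 hvθ x s
  have hdec := norm_flow_apply_le_of_apply_eq_zero hne hν (hsymm θ) (hG θ) hfl (θ * Complex.I)
    (apply_formProj hne x) hτ
  refine (norm_flow_shift_le (b := b) (u := v θ) (hG θ) θ hτ x).trans ?_
  have hA : ‖(b (v θ) (v θ))⁻¹‖ * (‖b‖ * ‖v θ‖ * ‖x‖) * ‖G θ (v θ) + (θ * Complex.I) • v θ‖ ≤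
      c2 * (‖b‖ * c1) * c3 * (|θ| ^ q * ‖x‖) := by
    calc _ ≤ c2 * (‖b‖ * c1 * ‖x‖) * (c3 * |θ| ^ q) := by gcongr
      _ = _ := by ring
  have hC : ‖flow (G θ) τ (formProj b (v θ) x)‖ ≤
      c5 * c7 * (Real.exp (-(ν * τ)) * (‖x - s • v 0‖ + |θ| * ‖x‖)) +
        c2 * (‖b‖ * c3) * c1 * c5 * c6 / ν * (|θ| ^ q * ‖x‖) := by
    refine hdec.trans (add_le_add ?_ ?_)
    · calc _ ≤ c5 * Real.exp (-(ν * τ)) * (c7 * (‖x - s • v 0‖ + |θ| * ‖x‖)) := by gcongr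
        _ = _ := by ring
    · calc _ ≤ c2 * (‖b‖ * (c3 * |θ| ^ q)) * c1 * c5 * (c6 * ‖x‖) / ν := by
            gcongr
            exact hR x
        _ = _ := by ring
  have hq : 0 ≤ |θ| ^ q * ‖x‖ := by positivity
  have he : 0 ≤ Real.exp (-(ν * τ)) * (‖x - s • v 0‖ + |θ| * ‖x‖) := by positivity
  refine (add_le_add hA (mul_le_mul_of_nonneg_left hC zero_le_two)).trans ?_
  generalize |θ| ^ q * ‖x‖ = X at *
  generalize Real.exp (-(ν * τ)) * (‖x - s • v 0‖ + |θ| * ‖x‖) = Y at *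
  linarith [mul_nonneg k1 he, mul_nonneg k2 hq, mul_nonneg k3 he]

end ModeBound

/-- The upwind symbol at angle `θ` is dissipative. -/
theorem re_inner_upwind_nonpos (p : ℕ) (θ : ℝ) (x : Cell p) :
    (inner ℂ x (upwind p (Complex.exp (-θ * Complex.I)) x)).re ≤ 0 := by
  rw [re_inner_upwind p (by simpa using Complex.norm_exp_ofReal_mul_I (-θ))]
  exact neg_nonpos.2 (by positivity)

/-- The constant function `1` in the cell space. -/
def Cell.one (p : ℕ) : Cell p := ⟨C 1, mem_degreeLT_succ.2 (by simp)⟩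

open Filter Topology in
/-- The defect of exact advection over one cell, for one Fourier mode. -/
theorem exists_norm_flow_upwind_shift_le (p : ℕ) {μ ν : ℝ} (hν : 0 < ν) (hνμ : ν < μ)
    (hμ : ∀ z : ℂ, IsNonphysicalRoot p z → μ ≤ z.re) :
    ∃ K : ℝ, 0 ≤ K ∧ ∀ θ τ : ℝ, 0 ≤ τ → ∀ (x : Cell p) (s : ℂ),
      ‖flow (upwind p (Complex.exp (-θ * Complex.I))) τ
        (Complex.exp (θ * Complex.I) • flow (upwind p (Complex.exp (-θ * Complex.I))) 1 x - x)‖ ≤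
        K * (|θ| ^ (2 * p + 2) * ‖x‖) +
          K * (Real.exp (-(ν * τ)) * (‖x - s • Cell.one p‖ + |θ| * ‖x‖)) := by
  obtain ⟨d, hd, hm⟩ := mode_zero_ne_zero p
  have hm1 : mode p 0 = d • Cell.one p := by
    ext1
    rw [hm, Submodule.coe_smul, Cell.one, smul_C, smul_eq_mul, mul_one]
  obtain ⟨c, hc, hpade⟩ := exists_norm_padeError_le p
  have hmd : DifferentiableAt ℝ (fun θ : ℝ => mode p (θ * Complex.I)) 0 := by
    have h1 : DifferentiableAt ℝ (mode p) (((0 : ℝ) : ℂ) * Complex.I) :=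
      ((differentiable_mode p) _).restrictScalars ℝ
    have h2 : DifferentiableAt ℝ (fun θ : ℝ => (θ : ℂ) * Complex.I) 0 :=
      (Complex.ofRealCLM.differentiableAt).mul_const _
    exact DifferentiableAt.comp (g := mode p) (0 : ℝ) h1 h2
  obtain ⟨C, hC, hev⟩ := exists_eventually_norm_flow_shift_le
    (G := fun θ : ℝ => upwind p (Complex.exp (-θ * Complex.I)))
    (v := fun θ : ℝ => mode p (θ * Complex.I)) (b := reflectForm p) (q := 2 * p + 2) hν hνμ
    (by unfold upwind; fun_prop) (re_inner_upwind_nonpos p) hmd.continuousAt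
    (by simpa using hmd.isBigO_sub) (fun θ x y => reflectForm_upwind p _ x y)
    (by
      refine Asymptotics.IsBigO.of_bound (c * ‖radauDeriv p 0‖) ?_
      filter_upwards [Metric.closedBall_mem_nhds (0 : ℝ) one_pos] with θ hθ
      rw [mem_closedBall_zero_iff] at hθ
      have hn : ‖(θ : ℂ) * Complex.I‖ = ‖θ‖ := by simp
      have := hpade (θ * Complex.I) (by rwa [hn])
      rw [hn, ← neg_mul] at this
      rw [upwind_mode, neg_add_cancel_comm, norm_smul, norm_mul, norm_pow, norm_neg, norm_one,
        one_pow, one_mul, norm_pow]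
      calc _ ≤ c * ‖θ‖ ^ (2 * p + 2) * ‖radauDeriv p 0‖ := by gcongr
        _ = _ := by ring)
    (by
      ext1
      simp [coe_upwind, hm])
    (by simpa using reflectForm_mode_zero_ne_zero p hd hm)
    (fun x hx hbx => by
      simp only [Complex.ofReal_zero, neg_zero, zero_mul, Complex.exp_zero] at hx hbx
      obtain ⟨e, he⟩ := exists_eq_C_of_upwind_eq_zero hx
      by_contra hne
      have he0 : e ≠ 0 := by
        rintro rfl
        exact hne (Subtype.ext (by simpa using he))
      exact reflectForm_mode_zero_ne_zero p he0 he hbx)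
    (fun k x hx hk h => by
      simp only [Complex.ofReal_zero, neg_zero, zero_mul, Complex.exp_zero] at h
      have := hμ _ (isNonphysicalRoot_of_upwind_eq hx hk h)
      rw [Complex.neg_re] at this
      linarith)
  obtain ⟨δ, hδ, hball⟩ := Metric.eventually_nhds_iff.1 hev
  refine ⟨C + 2 * δ⁻¹ ^ (2 * p + 2), by positivity, fun θ τ hτ x s => ?_⟩
  have hq : 0 ≤ |θ| ^ (2 * p + 2) * ‖x‖ := by positivity
  have he : 0 ≤ Real.exp (-(ν * τ)) * (‖x - s • Cell.one p‖ + |θ| * ‖x‖) := by positivity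
  have hk : 0 ≤ 2 * δ⁻¹ ^ (2 * p + 2) := by positivity
  rcases lt_or_ge |θ| δ with hlt | hge
  -- The limiting mode is `d` times the constant `1`, hence the rescaling of `s`.
  · have h := hball (y := θ) (by simpa using hlt) τ hτ x (s * d⁻¹)
    simp only [Complex.ofReal_zero, zero_mul, hm1, smul_smul] at h
    rw [mul_assoc, inv_mul_cancel₀ hd, mul_one] at h
    refine h.trans ?_
    gcongr <;> linarith
  -- For `|θ| ≥ δ` contraction bounds the defect by `2 ‖x‖`, which `(|θ| / δ) ^ (2 * p + 2) ≥ 1`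
  -- absorbs.
  · have hG := re_inner_upwind_nonpos p θ
    refine (norm_flow_apply_le_of_dissipative hG hτ _).trans ?_
    have h1 : 1 ≤ δ⁻¹ ^ (2 * p + 2) * |θ| ^ (2 * p + 2) := by
      rw [← mul_pow]
      exact one_le_pow₀ (by rw [inv_mul_eq_div, le_div_iff₀ hδ]; linarith)
    have h2 : ‖Complex.exp (θ * Complex.I) •
        flow (upwind p (Complex.exp (-θ * Complex.I))) 1 x - x‖ ≤ 2 * ‖x‖ := by
      refine (norm_sub_le _ _).trans ?_
      rw [norm_smul, Complex.norm_exp_ofReal_mul_I, one_mul, two_mul]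
      gcongr
      exact norm_flow_apply_le_of_dissipative hG zero_le_one _
    refine h2.trans ?_
    have h3 : 2 * ‖x‖ ≤ 2 * δ⁻¹ ^ (2 * p + 2) * (|θ| ^ (2 * p + 2) * ‖x‖) := by
      calc 2 * ‖x‖ = 2 * (1 * ‖x‖) := by ring
        _ ≤ 2 * ((δ⁻¹ ^ (2 * p + 2) * |θ| ^ (2 * p + 2)) * ‖x‖) := by gcongr
        _ = _ := by ring
    nlinarith [mul_nonneg hC hq, mul_nonneg hC he, mul_nonneg hk he]

/-! ### Discrete Fourier coefficients of periodic sequences -/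

section ModeCoeff

variable {N : ℕ} {E : Type*}

/-- The phase shift of the grid mode `n` over one cell. -/
def modeAngle (n : ZMod N) : ℝ := 2 * Real.pi * n.valMinAbs / N

theorem abs_modeAngle (n : ZMod N) : |modeAngle n| = 2 * Real.pi * |(n.valMinAbs : ℝ)| / N := by
  rw [modeAngle, abs_div, abs_mul, abs_of_pos Real.two_pi_pos, Nat.abs_cast]

variable [NeZero N]

theorem periodic_val_intCast {X : ℤ → E} (hX : ∀ j, X (j + N) = X j) (k : ℤ) :
    X ((k : ZMod N).val) = X k := by
  have hp : Function.Periodic X (N : ℤ) := hX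
  rw [ZMod.val_intCast]
  have h := hp.int_mul (k / N) (k % N)
  have e : k % N + k / N * N = k := by rw [mul_comm]; exact Int.emod_add_mul_ediv k N
  rw [Int.cast_id, e] at h
  exact h.symm

variable [NormedAddCommGroup E] [NormedSpace ℂ E]

/-- The coefficient of the grid mode `n` of an `N`-periodic sequence. -/
def modeCoeff (X : ℤ → E) (n : ZMod N) : E :=
  (N : ℂ)⁻¹ • ∑ j : ZMod N, ZMod.stdAddChar (-(j * n)) • X j.val

theorem stdAddChar_eq_exp_modeAngle (n : ZMod N) :
    ZMod.stdAddChar n = Complex.exp (modeAngle n * Complex.I) := by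
  conv_lhs => rw [← ZMod.coe_valMinAbs n]
  rw [ZMod.stdAddChar_coe, modeAngle]
  congr 1
  push_cast
  ring

theorem stdAddChar_neg_eq_exp_modeAngle (n : ZMod N) :
    ZMod.stdAddChar (-n) = Complex.exp (-modeAngle n * Complex.I) := by
  rw [AddChar.map_neg_eq_inv, stdAddChar_eq_exp_modeAngle, ← Complex.exp_neg, neg_mul]

theorem norm_stdAddChar (n : ZMod N) : ‖(ZMod.stdAddChar n : ℂ)‖ = 1 := by
  rw [stdAddChar_eq_exp_modeAngle, Complex.norm_exp_ofReal_mul_I]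

theorem abs_modeAngle_le (n : ZMod N) : |modeAngle n| ≤ Real.pi := by
  have hN : (0 : ℝ) < N := Nat.cast_pos.2 (NeZero.pos N)
  have h := n.valMinAbs_mem_Ioc
  have h1 : |(n.valMinAbs : ℝ)| * 2 ≤ N := by
    rw [← abs_two, ← abs_mul, abs_le]
    exact ⟨by exact_mod_cast h.1.le, by exact_mod_cast h.2⟩
  rw [abs_modeAngle, div_le_iff₀ hN]
  nlinarith [Real.pi_pos]

/-- Jordan's inequality for `2 |sin(θ/2)|`; the representative of least absolute value keeps `|θ| ≤
π`, where it applies. -/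
theorem le_norm_one_sub_stdAddChar_neg (n : ZMod N) :
    4 * |(n.valMinAbs : ℝ)| / N ≤ ‖1 - (ZMod.stdAddChar (-n) : ℂ)‖ := by
  have h1 : ‖1 - (ZMod.stdAddChar (-n) : ℂ)‖ = ‖2 * Real.sin (-modeAngle n / 2)‖ := by
    rw [← Complex.norm_exp_I_mul_ofReal_sub_one, stdAddChar_neg_eq_exp_modeAngle, norm_sub_rev,
      mul_comm Complex.I]
    push_cast
    rfl
  have h2 := Real.mul_abs_le_abs_sin (x := -modeAngle n / 2) (by
    rw [abs_div, abs_neg, abs_two]; linarith [abs_modeAngle_le n])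
  rw [abs_div, abs_neg, abs_two, abs_modeAngle] at h2
  rw [h1, norm_mul, Real.norm_eq_abs, Real.norm_eq_abs, abs_two]
  refine le_trans (le_of_eq ?_) (mul_le_mul_of_nonneg_left h2 zero_le_two)
  have := Real.pi_pos.ne'
  field_simp
  ring

theorem sum_smul_modeCoeff {X : ℤ → E} (hX : ∀ j, X (j + N) = X j) (k : ℤ) :
    X k = ∑ n : ZMod N, ZMod.stdAddChar ((k : ZMod N) * n) • modeCoeff X n := by
  have h := congrFun ((ZMod.dft (N := N) (E := E)).symm_apply_apply fun j => X j.val) (k : ZMod N)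
  rw [ZMod.invDFT_apply] at h
  rw [← periodic_val_intCast hX k, ← h, Finset.smul_sum]
  refine Finset.sum_congr rfl fun n _ => ?_
  rw [modeCoeff, ZMod.dft_apply, smul_comm, mul_comm]

theorem modeCoeff_shift {X : ℤ → E} (hX : ∀ j, X (j + N) = X j) (n : ZMod N) :
    modeCoeff (fun j => X (j - 1)) n = ZMod.stdAddChar (-n) • modeCoeff X n := by
  have h : ∀ j : ZMod N, X ((j.val : ℤ) - 1) = X ((j - 1).val) := by
    intro j
    rw [← periodic_val_intCast hX]
    simp
  rw [modeCoeff, modeCoeff, smul_comm (ZMod.stdAddChar (-n) : ℂ)]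
  congr 1
  rw [Finset.smul_sum, ← Equiv.sum_comp (Equiv.addRight (1 : ZMod N))
    fun j => ZMod.stdAddChar (-(j * n)) • X ((j.val : ℤ) - 1)]
  refine Finset.sum_congr rfl fun j _ => ?_
  rw [h, Equiv.coe_addRight, add_sub_cancel_right, smul_smul, ← AddChar.map_add_eq_mul]
  congr 2
  ring

theorem norm_modeCoeff_le {X : ℤ → E} {b : ℝ} (hX : ∀ j, ‖X j‖ ≤ b) (n : ZMod N) :
    ‖modeCoeff X n‖ ≤ b := by
  have hN : (0 : ℝ) < N := Nat.cast_pos.2 (NeZero.pos N)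
  rw [modeCoeff, norm_smul, norm_inv, RCLike.norm_natCast, inv_mul_le_iff₀ hN]
  refine (norm_sum_le_of_le (Finset.univ) (fun j _ => ?_)).trans_eq
    (b := ∑ _j : ZMod N, b) ?_
  · rw [norm_smul, norm_stdAddChar, one_mul]
    exact hX _
  · simp

theorem modeCoeff_sub (X Y : ℤ → E) (n : ZMod N) :
    modeCoeff (fun j => X j - Y j) n = modeCoeff X n - modeCoeff Y n := by
  simp [modeCoeff, smul_sub, Finset.sum_sub_distrib]

theorem modeCoeff_add (X Y : ℤ → E) (n : ZMod N) :
    modeCoeff (fun j => X j + Y j) n = modeCoeff X n + modeCoeff Y n := by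
  simp [modeCoeff, smul_add, Finset.sum_add_distrib]

theorem modeCoeff_smul_const (f : ℤ → ℂ) (x : E) (n : ZMod N) :
    modeCoeff (fun j => f j • x) n = modeCoeff f n • x := by
  simp only [modeCoeff, smul_smul, ← Finset.sum_smul, smul_eq_mul]

theorem modeCoeff_map {F : Type*} [NormedAddCommGroup F] [NormedSpace ℂ F] (T : E →L[ℂ] F)
    (X : ℤ → E) (n : ZMod N) : modeCoeff (fun j => T (X j)) n = T (modeCoeff X n) := by
  simp [modeCoeff]

theorem modeCoeff_const_smul (c : ℂ) (X : ℤ → E) (n : ZMod N) :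
    modeCoeff (fun j => c • X j) n = c • modeCoeff X n := by
  simp only [modeCoeff, Finset.smul_sum]
  refine Finset.sum_congr rfl fun j _ => ?_
  rw [smul_comm c, smul_comm c]

theorem hasDerivWithinAt_modeCoeff {X : ℤ → ℝ → E} {X' : ℤ → E} {s : Set ℝ} {t : ℝ}
    (h : ∀ j, HasDerivWithinAt (X j) (X' j) s t) (n : ZMod N) :
    HasDerivWithinAt (fun r => modeCoeff (fun j => X j r) n) (modeCoeff X' n) s t :=
  (HasDerivWithinAt.fun_sum fun (j : ZMod N) _ =>
    (h j.val).const_smul (ZMod.stdAddChar (-(j * n)))).const_smul ((N : ℂ)⁻¹)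

end ModeCoeff

/-! ### Discontinuous Galerkin solutions as a linear system -/

/-- Uniqueness for a linear equation: undoing the flow turns the solution into a constant. -/
theorem eq_flow_of_hasDerivWithinAt {V : Type*} [NormedAddCommGroup V] [InnerProductSpace ℂ V]
    [CompleteSpace V] {G : V →L[ℂ] V} {y : ℝ → V} {c : ℝ}
    (h : ∀ t, 0 ≤ t → HasDerivWithinAt y ((c : ℂ) • G (y t)) (Set.Ici 0) t) {t : ℝ} (ht : 0 ≤ t) :
    y t = flow G (c * t) (y 0) := by
  let F : ℝ → V := fun s => flow G (-(c * s)) (y s)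
  have hF : ∀ s, 0 ≤ s → HasDerivWithinAt F 0 (Set.Ici 0) s := by
    intro s hs
    have h0 : HasDerivAt (fun s : ℝ => -(c * s)) (-c) s := by
      simpa using (hasDerivAt_id' s).const_mul (-c)
    have h1 : HasDerivAt (fun s => flow G (-(c * s))) ((-c) • (G * flow G (-(c * s)))) s :=
      HasDerivAt.scomp (g₁ := flow G) s (hasDerivAt_flow G (-(c * s))) h0
    have h4 := (isBoundedBilinearMap_apply (𝕜 := ℂ) (E := V) (F := V)).hasFDerivAt
      (flow G (-(c * s)), y s)
    have h5 := (h4.restrictScalars ℝ).comp_hasDerivWithinAt s (h1.hasDerivWithinAt.prodMk (h s hs))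
    refine h5.congr_deriv ?_
    simp [flow_apply_comm]
  have hc := constant_of_has_deriv_right_zero (f := F) (a := 0) (b := t)
    (fun s hs => ((hF s hs.1).continuousWithinAt).mono Set.Icc_subset_Ici_self)
    (fun s hs => (hF s hs.1).mono (Set.Ici_subset_Ici.2 hs.1)) t (Set.right_mem_Icc.2 ht)
  simp only [F, mul_zero, neg_zero, flow_zero, one_apply_eq_self] at hc
  rw [← hc, ← flow_add_apply, add_neg_cancel, flow_zero, one_apply_eq_self]

/-- A polynomial as an element of the cell space (zero if its degree is too large). -/
def toCell (p : ℕ) (P : ℂ[X]) : Cell p :=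
  if h : P.natDegree ≤ p then ⟨P, mem_degreeLT_succ.2 h⟩ else 0

theorem coe_toCell {p : ℕ} {P : ℂ[X]} (h : P.natDegree ≤ p) : (toCell p P : ℂ[X]) = P := by
  simp [toCell, h]

theorem hasDerivWithinAt_of_inner {V : Type*} [NormedAddCommGroup V] [InnerProductSpace ℂ V]
    [FiniteDimensional ℂ V] {y : ℝ → V} {y' : V} {s : Set ℝ} {t : ℝ}
    (h : ∀ v : V, HasDerivWithinAt (fun r => inner ℂ v (y r)) (inner ℂ v y') s t) :
    HasDerivWithinAt y y' s t := by
  have e : ∀ x : V, x = ∑ i, inner ℂ (stdOrthonormalBasis ℂ V i) x • stdOrthonormalBasis ℂ V i :=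
    fun x => ((stdOrthonormalBasis ℂ V).sum_repr' x).symm
  have hs := HasDerivWithinAt.fun_sum (u := Finset.univ)
    fun i _ => (h (stdOrthonormalBasis ℂ V i)).smul_const (stdOrthonormalBasis ℂ V i)
  rw [← e y'] at hs
  have e' : y = fun r => ∑ i, inner ℂ (stdOrthonormalBasis ℂ V i) (y r) •
      stdOrthonormalBasis ℂ V i := funext fun r => e (y r)
  rw [e']
  exact hs

section DG

variable {p N : ℕ} {a h : ℝ} {U : ℤ → ℝ → ℂ[X]}

/-- The weak form is bilinear and the inner product conjugates its first argument, so the test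
polynomial is the conjugate of `v`. -/
theorem IsDGSolution.hasDerivWithinAt (hU : IsDGSolution p a h N U) (j : ℤ) {t : ℝ} (ht : 0 ≤ t) :
    HasDerivWithinAt (fun s => toCell p (U j s))
      (((a / h : ℝ) : ℂ) • (localOp p (toCell p (U j t)) + inflowOp p (toCell p (U (j - 1) t))))
      (Set.Ici 0) t := by
  refine hasDerivWithinAt_of_inner fun v => ?_
  have hv : (conjPoly (v : ℂ[X])).natDegree ≤ p := (natDegree_conjPoly_le _).trans v.natDegree_le
  have hw := hU.weak_form j t ht _ hv
  have e : ∀ s ∈ Set.Ici (0 : ℝ), inner ℂ v (toCell p (U j s)) =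
      ∫ ξ in (-1 : ℝ)..1, (U j s).eval (ξ : ℂ) * (conjPoly (v : ℂ[X])).eval (ξ : ℂ) := by
    intro s hs
    rw [Cell.inner_def, coe_toCell (hU.natDegree_le j s hs), ← cellIntegral_mul, mul_comm]
  refine (hw.congr e (e t ht)).congr_deriv ?_
  rw [Cell.inner_def, mul_comm (conjPoly _), Submodule.coe_smul, Submodule.coe_add,
    smul_mul_assoc, map_smul, add_mul, map_add, cellIntegral_localOp_mul p _ _ hv,
    cellIntegral_inflowOp_mul p _ _ hv, coe_toCell (hU.natDegree_le j t ht),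
    coe_toCell (hU.natDegree_le (j - 1) t ht), ← cellIntegral_mul, smul_eq_mul]
  push_cast
  ring

theorem IsDGSolution.modeCoeff_eq_flow [NeZero N] (hU : IsDGSolution p a h N U) (n : ZMod N)
    {t : ℝ} (ht : 0 ≤ t) : modeCoeff (fun j => toCell p (U j t)) n =
      flow (upwind p (Complex.exp (-modeAngle n * Complex.I))) (a / h * t)
        (modeCoeff (fun j => toCell p (U j 0)) n) := by
  refine eq_flow_of_hasDerivWithinAt (y := fun s => modeCoeff (fun j => toCell p (U j s)) n)
    (fun s hs => ?_) ht
  refine (hasDerivWithinAt_modeCoeff (fun j => hU.hasDerivWithinAt j hs) n).congr_deriv ?_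
  rw [modeCoeff_const_smul, modeCoeff_add, modeCoeff_map, modeCoeff_map,
    modeCoeff_shift (X := fun j => toCell p (U j s)) (fun j => by rw [hU.periodic j s hs]),
    stdAddChar_neg_eq_exp_modeAngle, map_smul]
  rfl

/-- The advection defect is bounded by the sum of the defects of the grid modes. -/
theorem IsDGSolution.norm_shift_le [NeZero N] (hU : IsDGSolution p a h N U) (ha : 0 < a)
    (hh : 0 < h) (j : ℤ) {t : ℝ} (ht : 0 ≤ t) :
    ‖toCell p (U (j + 1) (t + h / a)) - toCell p (U j t)‖ ≤ ∑ n : ZMod N,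
      ‖flow (upwind p (Complex.exp (-modeAngle n * Complex.I))) (a / h * t)
        (Complex.exp (modeAngle n * Complex.I) •
          flow (upwind p (Complex.exp (-modeAngle n * Complex.I))) 1
            (modeCoeff (fun j => toCell p (U j 0)) n) -
          modeCoeff (fun j => toCell p (U j 0)) n)‖ := by
  have ht' : 0 ≤ t + h / a := by positivity
  have e1 := sum_smul_modeCoeff (N := N) (X := fun j => toCell p (U j (t + h / a)))
    (fun j => by rw [hU.periodic j _ ht']) (j + 1)
  have e2 := sum_smul_modeCoeff (N := N) (X := fun j => toCell p (U j t))
    (fun j => by rw [hU.periodic j _ ht]) j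
  beta_reduce at e1 e2
  rw [e1, e2, ← Finset.sum_sub_distrib]
  refine norm_sum_le_of_le _ fun n _ => le_of_eq ?_
  -- The time `h / a` is one unit of rescaled time, and moving on by one cell multiplies the mode by
  -- `e^{iθ}`.
  rw [hU.modeCoeff_eq_flow n ht', hU.modeCoeff_eq_flow n ht,
    show a / h * (t + h / a) = a / h * t + 1 by field_simp, flow_add_apply,
    Int.cast_add, Int.cast_one, add_mul, one_mul, AddChar.map_add_eq_mul, ← smul_smul, ← smul_sub,
    norm_smul, norm_stdAddChar, one_mul, stdAddChar_eq_exp_modeAngle, ← map_smul, ← map_sub]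

end DG

/-! ### Grid modes of projected smooth data -/

theorem toCell_sub {p : ℕ} {P Q : ℂ[X]} (hP : P.natDegree ≤ p) (hQ : Q.natDegree ≤ p) :
    toCell p (P - Q) = toCell p P - toCell p Q := by
  ext1
  rw [Submodule.coe_sub, coe_toCell hP, coe_toCell hQ,
    coe_toCell ((natDegree_sub_le _ _).trans (max_le hP hQ))]

/-- The backward difference with step `h`. -/
def backDiff (h : ℝ) (F : ℝ → ℂ) (x : ℝ) : ℂ := F x - F (x - h)

theorem contDiff_backDiff (h : ℝ) {F : ℝ → ℂ} (hF : ContDiff ℝ ∞ F) :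
    ContDiff ℝ ∞ (backDiff h F) :=
  hF.sub (hF.comp (contDiff_id.sub contDiff_const))

theorem periodic_backDiff (h : ℝ) {F : ℝ → ℂ} {L : ℝ} (hF : Function.Periodic F L) :
    Function.Periodic (backDiff h F) L := by
  intro x
  rw [backDiff, backDiff, hF x, show x + L - h = x - h + L by ring, hF]

theorem contDiff_iterate_backDiff (h : ℝ) {F : ℝ → ℂ} (hF : ContDiff ℝ ∞ F) (m : ℕ) :
    ContDiff ℝ ∞ ((backDiff h)^[m] F) := by
  induction m with
  | zero => exact hF
  | succ m ih => rw [Function.iterate_succ_apply']; exact contDiff_backDiff h ih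

theorem periodic_iterate_backDiff (h : ℝ) {F : ℝ → ℂ} {L : ℝ} (hF : Function.Periodic F L)
    (m : ℕ) : Function.Periodic ((backDiff h)^[m] F) L := by
  induction m with
  | zero => exact hF
  | succ m ih => rw [Function.iterate_succ_apply']; exact periodic_backDiff h ih

theorem contDiff_nat {F : ℝ → ℂ} (hF : ContDiff ℝ ∞ F) (i : ℕ) : ContDiff ℝ i F :=
  hF.of_le (by exact_mod_cast le_top)

theorem norm_iteratedDeriv_backDiff_le {h : ℝ} (hh : 0 ≤ h) {F : ℝ → ℂ} (hF : ContDiff ℝ ∞ F)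
    {i : ℕ} {b : ℝ} (hb : ∀ x, ‖iteratedDeriv (i + 1) F x‖ ≤ b) (x : ℝ) :
    ‖iteratedDeriv i (backDiff h F) x‖ ≤ h * b := by
  have h1 : iteratedDeriv i (backDiff h F) x =
      iteratedDeriv i F x - iteratedDeriv i F (x - h) := by
    have e : backDiff h F = F - fun z => F (z - h) := rfl
    have hc : ContDiff ℝ i fun z => F (z - h) :=
      (contDiff_nat hF i).comp (contDiff_id.sub contDiff_const)
    rw [e, iteratedDeriv_sub (contDiff_nat hF i).contDiffAt hc.contDiffAt,
      iteratedDeriv_comp_sub_const]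
  have h2 := Convex.norm_image_sub_le_of_norm_deriv_le (𝕜 := ℝ) (f := iteratedDeriv i F) (C := b)
    (s := Set.univ) (x := x - h) (y := x)
    (fun y _ => (hF.differentiable_iteratedDeriv i (by exact_mod_cast ENat.natCast_lt_top i)) y)
    (fun y _ => by rw [← iteratedDeriv_succ]; exact hb y) convex_univ trivial trivial
  rw [h1]
  refine h2.trans_eq ?_
  rw [sub_sub_cancel, Real.norm_of_nonneg hh, mul_comm]

theorem norm_iteratedDeriv_iterate_backDiff_le {h : ℝ} (hh : 0 ≤ h) {F : ℝ → ℂ}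
    (hF : ContDiff ℝ ∞ F) {i m : ℕ} {b : ℝ} (hb : ∀ x, ‖iteratedDeriv (i + m) F x‖ ≤ b) (x : ℝ) :
    ‖iteratedDeriv i ((backDiff h)^[m] F) x‖ ≤ h ^ m * b := by
  induction m generalizing F b with
  | zero => simpa using hb x
  | succ m ih =>
    rw [Function.iterate_succ_apply]
    refine (ih (contDiff_backDiff h hF) (b := h * b) fun y =>
      norm_iteratedDeriv_backDiff_le hh hF hb y).trans_eq ?_
    ring

theorem exists_bound_iteratedDeriv {u : ℝ → ℂ} (hu : ContDiff ℝ ∞ u) {L : ℝ} (hL : L ≠ 0)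
    (hper : Function.Periodic u L) (k : ℕ) :
    ∃ b : ℝ, 0 ≤ b ∧ ∀ i ≤ k, ∀ x, ‖iteratedDeriv i u x‖ ≤ b := by
  have h1 : ∀ i, ∃ b : ℝ, ∀ x, ‖iteratedDeriv i u x‖ ≤ b := by
    intro i
    have hp : Function.Periodic (iteratedDeriv i u) L := by
      intro x
      have e := congrFun (iteratedDeriv_comp_add_const i u L) x
      have hs : (fun z => u (z + L)) = u := funext hper
      rw [hs] at e
      exact e.symm
    obtain ⟨b, hb⟩ := (hp.isBounded_of_continuous hL
      (hu.continuous_iteratedDeriv i (by exact_mod_cast le_top))).exists_norm_le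
    exact ⟨b, fun x => hb _ ⟨x, rfl⟩⟩
  choose b hb using h1
  have hb0 : ∀ i, 0 ≤ b i := fun i => (norm_nonneg _).trans (hb i 0)
  refine ⟨∑ i ∈ Finset.range (k + 1), b i, Finset.sum_nonneg fun i _ => hb0 i, fun i hi x => ?_⟩
  exact (hb i x).trans
    (Finset.single_le_sum (fun i _ => hb0 i) (Finset.mem_range.2 (Nat.lt_succ_of_le hi)))

theorem onCell_eq (u : ℝ → ℂ) (x₀ h : ℝ) (j : ℤ) :
    onCell u x₀ h j = fun ξ => u ((x₀ + j * h + h / 2) + h / 2 * ξ) := by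
  funext ξ
  rw [onCell]
  congr 1
  ring

theorem contDiff_onCell {u : ℝ → ℂ} (hu : ContDiff ℝ ∞ u) (x₀ h : ℝ) (j : ℤ) :
    ContDiff ℝ ∞ (onCell u x₀ h j) := by
  rw [onCell_eq]
  exact hu.comp (contDiff_const.add (contDiff_const.mul contDiff_id))

theorem onCell_add_period {u : ℝ → ℂ} {L : ℝ} (hu : Function.Periodic u L) (x₀ : ℝ) {N : ℕ}
    [NeZero N] (j : ℤ) : onCell u x₀ (L / N) (j + N) = onCell u x₀ (L / N) j := by
  funext ξ
  have hN : (N : ℝ) ≠ 0 := NeZero.ne _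
  rw [onCell, onCell, ← hu (x₀ + j * (L / N) + L / N / 2 * (ξ + 1))]
  congr 1
  push_cast
  field_simp
  ring

theorem norm_iteratedDeriv_onCell_le {u : ℝ → ℂ} (hu : ContDiff ℝ ∞ u) (x₀ : ℝ) {h : ℝ}
    (hh : 0 ≤ h) (j : ℤ) {r i : ℕ} (hi : i ≤ r) {b : ℝ} (hb : ∀ x, ‖iteratedDeriv i u x‖ ≤ b)
    (ξ : ℝ) : ‖iteratedDeriv i (onCell u x₀ h j) ξ‖ ≤ (1 + h) ^ r * b := by
  have hb0 : 0 ≤ b := (norm_nonneg _).trans (hb 0)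
  have hc : ContDiff ℝ i fun y => u ((x₀ + j * h + h / 2) + y) :=
    (contDiff_nat hu i).comp (contDiff_const.add contDiff_id)
  rw [onCell_eq, iteratedDeriv_comp_const_smul hc (h / 2), iteratedDeriv_comp_const_add,
    norm_smul, norm_pow, Real.norm_of_nonneg (by positivity)]
  have h1 : (h / 2) ^ i ≤ (1 + h) ^ r :=
    (pow_le_pow_left₀ (by positivity) (by linarith) i).trans
      (pow_le_pow_right₀ (by linarith) hi)
  exact mul_le_mul h1 (hb _) (norm_nonneg _) (by positivity)

/-- Projected data on the cells of a mesh of size `h`. -/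
def cellData (p : ℕ) (Q : (ℝ → ℂ) → ℂ[X]) (u : ℝ → ℂ) (x₀ h : ℝ) (j : ℤ) : Cell p :=
  toCell p (Q (onCell u x₀ h j))

section Projection

variable {p r : ℕ} {B : ℝ} {Q : (ℝ → ℂ) → ℂ[X]}

theorem IsCellProjection.map_sub (hQ : IsCellProjection p r B Q) {v w : ℝ → ℂ}
    (hv : ContDiff ℝ ∞ v) (hw : ContDiff ℝ ∞ w) : Q (fun ξ => v ξ - w ξ) = Q v - Q w := by
  have h1 := hQ.map_add v (fun ξ => (-1) * w ξ) hv (contDiff_const.mul hw)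
  rw [hQ.map_smul (-1) w hw] at h1
  have e : (fun ξ => v ξ - w ξ) = fun ξ => v ξ + (-1) * w ξ := by funext ξ; ring
  rw [e, h1]
  simp [sub_eq_add_neg]

theorem IsCellProjection.mono (hQ : IsCellProjection p r B Q) {B' : ℝ} (h : B ≤ B') :
    IsCellProjection p r B' Q where
  natDegree_le := hQ.natDegree_le
  map_add := hQ.map_add
  map_smul := hQ.map_smul
  bound v hv b hb ξ hξ := (hQ.bound v hv b hb ξ hξ).trans
    (mul_le_mul_of_nonneg_right h ((norm_nonneg _).trans (hb 0 (Nat.zero_le _) ξ hξ)))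

/-- The difference between a projection and the evaluation at the left end point. -/
theorem IsCellProjection.sub_eval (hQ : IsCellProjection p r B Q) :
    IsCellProjection p r (B + 1) fun v => Q v - C (v (-1)) where
  natDegree_le v hv := (natDegree_sub_le _ _).trans (max_le (hQ.natDegree_le v hv) (by simp))
  map_add v w hv hw := by
    rw [hQ.map_add v w hv hw, C_add]
    ring
  map_smul c v hv := by
    rw [hQ.map_smul c v hv, C_mul]
    ring
  bound v hv b hb ξ hξ := by
    have h1 := hQ.bound v hv b hb ξ hξ
    have h2 : ‖v (-1)‖ ≤ b := by simpa using hb 0 (Nat.zero_le _) (-1) (by simp)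
    rw [eval_sub, eval_C]
    exact (norm_sub_le _ _).trans (by linarith)

/-- This is where using the same linear projection on all cells matters: differencing neighbouring
cells is projecting the difference of the profile. -/
theorem IsCellProjection.cellData_backDiff (hQ : IsCellProjection p r B Q) {u : ℝ → ℂ}
    (hu : ContDiff ℝ ∞ u) (x₀ h : ℝ) (j : ℤ) :
    cellData p Q (backDiff h u) x₀ h j = cellData p Q u x₀ h j - cellData p Q u x₀ h (j - 1) := by
  have e : onCell (backDiff h u) x₀ h j =
      fun ξ => onCell u x₀ h j ξ - onCell u x₀ h (j - 1) ξ := by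
    funext ξ
    simp only [onCell, backDiff]
    congr 2
    push_cast
    ring
  have h1 := contDiff_onCell hu x₀ h j
  have h2 := contDiff_onCell hu x₀ h (j - 1)
  rw [cellData, e, hQ.map_sub h1 h2, toCell_sub (hQ.natDegree_le _ h1) (hQ.natDegree_le _ h2)]
  rfl

theorem cellData_add_period {u : ℝ → ℂ} {L : ℝ} (hu : Function.Periodic u L) (x₀ : ℝ) {N : ℕ}
    [NeZero N] (j : ℤ) : cellData p Q u x₀ (L / N) (j + N) = cellData p Q u x₀ (L / N) j := by
  rw [cellData, onCell_add_period hu, cellData]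

theorem IsCellProjection.modeCoeff_iterate_backDiff (hQ : IsCellProjection p r B Q) {u : ℝ → ℂ}
    (hu : ContDiff ℝ ∞ u) {L : ℝ} (hper : Function.Periodic u L) (x₀ : ℝ) {N : ℕ} [NeZero N]
    (n : ZMod N) (m : ℕ) :
    modeCoeff (cellData p Q ((backDiff (L / N))^[m] u) x₀ (L / N)) n =
      (1 - (ZMod.stdAddChar (-n) : ℂ)) ^ m • modeCoeff (cellData p Q u x₀ (L / N)) n := by
  induction m with
  | zero => simp
  | succ m ih =>
    have e : cellData p Q ((backDiff (L / N))^[m + 1] u) x₀ (L / N) = fun j =>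
        cellData p Q ((backDiff (L / N))^[m] u) x₀ (L / N) j -
          cellData p Q ((backDiff (L / N))^[m] u) x₀ (L / N) (j - 1) := by
      funext j
      rw [Function.iterate_succ_apply',
        hQ.cellData_backDiff (contDiff_iterate_backDiff _ hu m)]
    rw [e, modeCoeff_sub, modeCoeff_shift
      (cellData_add_period (periodic_iterate_backDiff _ hper m) x₀), ih]
    module

theorem IsCellProjection.norm_cellData_le (hQ : IsCellProjection p r B Q) {u : ℝ → ℂ}
    (hu : ContDiff ℝ ∞ u) (x₀ : ℝ) {h : ℝ} (hh : 0 ≤ h) {b : ℝ}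
    (hb : ∀ i ≤ r, ∀ x, ‖iteratedDeriv i u x‖ ≤ b) (j : ℤ) :
    ‖cellData p Q u x₀ h j‖ ≤ 2 * (B * ((1 + h) ^ r * b)) := by
  have hc := contDiff_onCell hu x₀ h j
  refine Cell.norm_le_of_forall_eval _ fun ξ hξ => ?_
  rw [cellData, coe_toCell (hQ.natDegree_le _ hc)]
  exact hQ.bound _ hc _
    (fun i hi ξ _ => norm_iteratedDeriv_onCell_le hu x₀ hh j hi (hb i hi) ξ) ξ hξ

end Projection

/-- The grid modes of projected smooth data decay faster than any power. -/
theorem exists_pow_mul_norm_modeCoeff_le (p r : ℕ) {u : ℝ → ℂ} (hu : ContDiff ℝ ∞ u) {L : ℝ}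
    (hL : 0 < L) (hper : Function.Periodic u L) (x₀ : ℝ) (m : ℕ) :
    ∃ K : ℝ, 0 ≤ K ∧ ∀ (N : ℕ) [NeZero N] (B : ℝ) (Q : (ℝ → ℂ) → ℂ[X]), 0 ≤ B →
      IsCellProjection p r B Q → ∀ n : ZMod N,
        |(n.valMinAbs : ℝ)| ^ m * ‖modeCoeff (cellData p Q u x₀ (L / N)) n‖ ≤ K * B := by
  -- Of the `r + m` derivatives, `m` are spent on the backward differences and `r` on the norm in
  -- which the projection is bounded.
  obtain ⟨b, hb0, hb⟩ := exists_bound_iteratedDeriv hu hL.ne' hper (r + m)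
  refine ⟨2 * ((1 + L) ^ r * b) * (L / 4) ^ m, by positivity, fun N _ B Q hB hQ n => ?_⟩
  have hN : (1 : ℝ) ≤ N := by exact_mod_cast NeZero.one_le
  have hN0 : (0 : ℝ) < N := by linarith
  set h := L / N with hh
  have hh0 : 0 ≤ h := by positivity
  have hhL : h ≤ L := div_le_self hL.le hN
  have h1 : ‖modeCoeff (cellData p Q ((backDiff h)^[m] u) x₀ h) n‖ ≤
      2 * (B * ((1 + h) ^ r * (h ^ m * b))) :=
    norm_modeCoeff_le (hQ.norm_cellData_le (contDiff_iterate_backDiff h hu m) x₀ hh0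
      fun i hi x => norm_iteratedDeriv_iterate_backDiff_le hh0 hu
        (hb (i + m) (Nat.add_le_add_right hi m)) x) n
  rw [hQ.modeCoeff_iterate_backDiff hu hper, norm_smul, norm_pow] at h1
  set A := ‖modeCoeff (cellData p Q u x₀ h) n‖
  have h2 : (4 * |(n.valMinAbs : ℝ)| / N) ^ m * A ≤ 2 * (B * ((1 + L) ^ r * (h ^ m * b))) := by
    refine le_trans ?_ (h1.trans ?_)
    · gcongr
      exact le_norm_one_sub_stdAddChar_neg n
    · gcongr
  have h3 : |(n.valMinAbs : ℝ)| ^ m * A = (N / 4 : ℝ) ^ m *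
      ((4 * |(n.valMinAbs : ℝ)| / N) ^ m * A) := by
    rw [← mul_assoc, ← mul_pow]
    congr 2
    field_simp
  rw [h3]
  calc _ ≤ (N / 4 : ℝ) ^ m * (2 * (B * ((1 + L) ^ r * (h ^ m * b)))) := by gcongr
    _ = 2 * ((1 + L) ^ r * b) * (N / 4 * h) ^ m * B := by rw [mul_pow]; ring
    _ = _ := by
      congr 3
      rw [hh]
      field_simp

/-! ### The initial data -/

theorem norm_integral_onCell_sub_mul_le {u : ℝ → ℂ} (hu : ContDiff ℝ ∞ u) {b : ℝ}
    (hb : ∀ x, ‖iteratedDeriv 1 u x‖ ≤ b) (x₀ : ℝ) {h : ℝ} (hh : 0 ≤ h) (j : ℤ) (P : ℂ[X]) {c : ℝ}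
    (hc : ∀ ξ ∈ Set.Icc (-1 : ℝ) 1, ‖P.eval (ξ : ℂ)‖ ≤ c) :
    ‖∫ ξ in (-1 : ℝ)..1, (onCell u x₀ h j ξ - onCell u x₀ h j (-1)) * P.eval (ξ : ℂ)‖ ≤
      2 * b * c * h := by
  have hb0 : 0 ≤ b := (norm_nonneg _).trans (hb 0)
  have := intervalIntegral.norm_integral_le_of_norm_le_const (a := (-1 : ℝ)) (b := 1)
    (f := fun ξ : ℝ => (onCell u x₀ h j ξ - onCell u x₀ h j (-1)) * P.eval (ξ : ℂ))
    (C := b * h * c) (fun ξ hξ => by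
      rw [Set.uIoc_of_le (by norm_num)] at hξ
      have hξ' : ξ ∈ Set.Icc (-1 : ℝ) 1 := ⟨hξ.1.le, hξ.2⟩
      rw [norm_mul]
      refine mul_le_mul ?_ (hc ξ hξ') (norm_nonneg _) (by positivity)
      have h1 := Convex.norm_image_sub_le_of_norm_deriv_le (𝕜 := ℝ) (f := u) (C := b)
        (s := Set.univ) (x := x₀ + j * h + h / 2 * (-1 + 1)) (y := x₀ + j * h + h / 2 * (ξ + 1))
        (fun y _ => hu.differentiable (by simp) y)
        (fun y _ => by rw [← iteratedDeriv_one]; exact hb y) convex_univ trivial trivial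
      refine h1.trans (mul_le_mul_of_nonneg_left ?_ hb0)
      rw [show x₀ + j * h + h / 2 * (ξ + 1) - (x₀ + j * h + h / 2 * (-1 + 1)) =
        h / 2 * (ξ + 1) by ring, Real.norm_of_nonneg
        (mul_nonneg (by positivity) (by linarith [hξ'.1]))]
      nlinarith [hξ'.2])
  refine this.trans_eq ?_
  norm_num
  ring

/-- The initial data differ from the values at the left end points by `O(h)`. -/
theorem exists_norm_cellData_sub_eval_le (p : ℕ) {u : ℝ → ℂ} (hu : ContDiff ℝ ∞ u) {L : ℝ}
    (hL : 0 < L) (hper : Function.Periodic u L) (x₀ C₀ : ℝ) :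
    ∃ K : ℝ, 0 ≤ K ∧ ∀ (h : ℝ), 0 < h → h ≤ L → ∀ (j : ℤ) (P : ℂ[X]), P.natDegree ≤ p →
      (∀ k ≤ p, ‖∫ ξ in (-1 : ℝ)..1, (P.eval (ξ : ℂ) - onCell u x₀ h j ξ)
        * (legendre k).eval (ξ : ℂ)‖ ≤ C₀ * h ^ (2 * p + 1 - k)) →
      ‖toCell p (P - C (onCell u x₀ h j (-1)))‖ ≤ K * h := by
  obtain ⟨b, hb0, hb⟩ := exists_bound_iteratedDeriv hu hL.ne' hper 1
  obtain ⟨c, hc0, hc⟩ : ∃ c : ℝ, 0 ≤ c ∧ ∀ k ≤ p, ∀ ξ ∈ Set.Icc (-1 : ℝ) 1,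
      ‖(legendre k).eval (ξ : ℂ)‖ ≤ c := by
    have h1 : ∀ k, ∃ c : ℝ, ∀ ξ ∈ Set.Icc (-1 : ℝ) 1, ‖(legendre k).eval (ξ : ℂ)‖ ≤ c := fun k =>
      isCompact_Icc.exists_bound_of_continuousOn (continuous_eval_ofReal (legendre k)).continuousOn
    choose c hc using h1
    have hc0 : ∀ k, 0 ≤ c k := fun k => (norm_nonneg _).trans (hc k 0 (by simp))
    exact ⟨∑ k ∈ Finset.range (p + 1), c k, Finset.sum_nonneg fun k _ => hc0 k,
      fun k hk ξ hξ => (hc k ξ hξ).trans (Finset.single_le_sum (fun k _ => hc0 k)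
        (Finset.mem_range.2 (Nat.lt_succ_of_le hk)))⟩
  obtain ⟨d, hd0, hd⟩ := Cell.exists_norm_le_of_moments p
  refine ⟨d * (|C₀| * (1 + L) ^ (2 * p) + 2 * b * c), by positivity,
    fun h hh hhL j P hP hm => ?_⟩
  have hdeg : (P - C (onCell u x₀ h j (-1))).natDegree ≤ p :=
    (natDegree_sub_le _ _).trans (max_le hP (by simp))
  rw [mul_assoc]
  refine hd _ _ (by positivity) fun k hk => ?_
  rw [coe_toCell hdeg, cellIntegral_mul]
  have hcont : Continuous (onCell u x₀ h j) := (contDiff_onCell hu x₀ h j).continuous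
  have hP' := continuous_eval_ofReal P
  have hl := continuous_eval_ofReal (legendre k)
  have e : ∫ ξ in (-1 : ℝ)..1, (P - C (onCell u x₀ h j (-1))).eval (ξ : ℂ) *
        (legendre k).eval (ξ : ℂ) =
      (∫ ξ in (-1 : ℝ)..1, (P.eval (ξ : ℂ) - onCell u x₀ h j ξ) * (legendre k).eval (ξ : ℂ)) +
      ∫ ξ in (-1 : ℝ)..1, (onCell u x₀ h j ξ - onCell u x₀ h j (-1)) *
        (legendre k).eval (ξ : ℂ) := by
    rw [← intervalIntegral.integral_add]
    · congr 1
      funext ξ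
      rw [eval_sub, eval_C]
      ring
    · exact Continuous.intervalIntegrable (by fun_prop) _ _
    · exact Continuous.intervalIntegrable (by fun_prop) _ _
  rw [e]
  -- Because `k ≤ p`, at least one factor `h` remains; the other factors are bounded.
  have h1 : C₀ * h ^ (2 * p + 1 - k) ≤ |C₀| * (1 + L) ^ (2 * p) * h := by
    have e2 : 2 * p + 1 - k = (2 * p - k) + 1 := by omega
    have h2 : h ^ (2 * p - k) ≤ (1 + L) ^ (2 * p) :=
      (pow_le_pow_left₀ hh.le (by linarith) _).trans
        (pow_le_pow_right₀ (by linarith) (Nat.sub_le _ _))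
    rw [e2, pow_succ]
    calc C₀ * (h ^ (2 * p - k) * h) ≤ |C₀| * ((1 + L) ^ (2 * p) * h) := by
          gcongr
          exact le_abs_self _
      _ = _ := by ring
  calc _ ≤ |C₀| * (1 + L) ^ (2 * p) * h + 2 * b * c * h :=
        (norm_add_le _ _).trans (add_le_add ((hm k hk).trans h1)
          (norm_integral_onCell_sub_mul_le hu (hb 1 le_rfl) x₀ hh.le j _ (hc k hk)))
    _ = _ := by ring

/-! ### Summation over the grid modes -/

/-- A bounded quantity that decays like every power of `d`, up to the factor `N ^ s`, decays like
every power up to the factor `√N`. -/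
theorem exists_pow_mul_le_sqrt (s : ℕ) (K₀ : ℝ) (Km : ℕ → ℝ) (k : ℕ) :
    ∃ K : ℝ, 0 ≤ K ∧ ∀ N d A : ℝ, 1 ≤ N → 0 ≤ d → 0 ≤ A → A ≤ K₀ →
      (∀ m, d ^ m * A ≤ Km m * N ^ s) → d ^ k * A ≤ K * √N := by
  refine ⟨max 1 (Km (k * (2 * s + 1)) * K₀ ^ (2 * s)), by positivity,
    fun N d A hN hd hA hA0 hm => ?_⟩
  set K := max 1 (Km (k * (2 * s + 1)) * K₀ ^ (2 * s))
  have hK1 : 1 ≤ K := le_max_left _ _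
  have hs1 : 1 ≤ √N := Real.one_le_sqrt.2 hN
  have hN0 : 0 ≤ N := by linarith
  refine le_of_pow_le_pow_left₀ (n := 2 * s + 1) (by omega) (by positivity) ?_
  -- One factor `A` absorbs all powers of `d` at the cost `N ^ s`; the other `2 * s` factors are
  -- merely bounded. Taking the root leaves less than `√N`.
  have h1 : (d ^ k * A) ^ (2 * s + 1) = d ^ (k * (2 * s + 1)) * A * A ^ (2 * s) := by
    rw [mul_pow, ← pow_mul]; ring
  have h2 : N ^ s ≤ √N ^ (2 * s + 1) := by
    rw [pow_succ, pow_mul, Real.sq_sqrt hN0]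
    exact le_mul_of_one_le_right (by positivity) hs1
  have h3 : 0 ≤ Km (k * (2 * s + 1)) * N ^ s := le_trans (by positivity) (hm _)
  rw [h1, mul_pow]
  calc _ ≤ Km (k * (2 * s + 1)) * N ^ s * K₀ ^ (2 * s) :=
        mul_le_mul (hm _) (pow_le_pow_left₀ hA hA0 _) (by positivity) h3
    _ = Km (k * (2 * s + 1)) * K₀ ^ (2 * s) * N ^ s := by ring
    _ ≤ K * N ^ s := by
        gcongr
        exact le_max_right _ _
    _ ≤ K ^ (2 * s + 1) * √N ^ (2 * s + 1) := by
        gcongr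
        exact le_self_pow₀ hK1 (by omega)

/-- Least absolute representatives embed `ZMod N` in `ℤ`, so one convergent series over `ℤ` bounds
the sums for all `N`. -/
theorem exists_sum_valMinAbs_le : ∃ S : ℝ, 0 ≤ S ∧ ∀ (N : ℕ) [NeZero N],
    ∑ n : ZMod N, (1 + |(n.valMinAbs : ℝ)| ^ 2)⁻¹ ≤ S := by
  have hsum : Summable fun m : ℤ => (1 + |(m : ℝ)| ^ 2)⁻¹ := by
    refine Summable.of_norm_bounded_eventually
      (Real.summable_one_div_int_pow.2 (by norm_num : 1 < 2)) ?_
    filter_upwards [(Set.finite_singleton (0 : ℤ)).compl_mem_cofinite] with m hm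
    have hm0 : (m : ℝ) ≠ 0 := by exact_mod_cast hm
    have : 0 < (m : ℝ) ^ 2 := by positivity
    rw [sq_abs, Real.norm_of_nonneg (by positivity), one_div]
    exact inv_anti₀ this (by linarith)
  refine ⟨∑' m : ℤ, (1 + |(m : ℝ)| ^ 2)⁻¹, tsum_nonneg fun m => by positivity, fun N _ => ?_⟩
  have h1 := hsum.sum_le_tsum (Finset.univ.map ⟨ZMod.valMinAbs (n := N), ZMod.injective_valMinAbs⟩)
    (fun m _ => by positivity)
  rwa [Finset.sum_map] at h1

/-- The reduced rate is chosen so that raising `h ^ (2 * p + 1)` to the power `1 - 1 / (2 * (2 * p +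
1))` loses exactly `√h`. -/
theorem exp_neg_mul_le_of_exp_le {p : ℕ} {μ τ M h : ℝ} (hh : 0 < h)
    (hM : Real.exp (-(μ * τ)) ≤ M * h ^ (2 * p + 1)) :
    Real.exp (-(μ * (1 - 1 / (2 * (2 * p + 1))) * τ)) ≤
      M ^ (1 - 1 / (2 * (2 * p + 1)) : ℝ) * (h ^ (2 * p + 1) / √h) := by
  have hM0 : 0 < M := pos_of_mul_pos_left ((Real.exp_pos _).trans_le hM) (by positivity)
  set κ : ℝ := 1 - 1 / (2 * (2 * p + 1)) with hκ
  have hp : (0 : ℝ) < 2 * p + 1 := by positivity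
  have hκ0 : 0 ≤ κ := by
    rw [hκ, sub_nonneg, div_le_one (by positivity)]
    have : (0 : ℝ) ≤ p := p.cast_nonneg
    linarith
  have h1 := Real.rpow_le_rpow (Real.exp_pos _).le hM hκ0
  rw [← Real.exp_mul, Real.mul_rpow hM0.le (by positivity)] at h1
  have e1 : -(μ * τ) * κ = -(μ * κ * τ) := by ring
  rw [e1] at h1
  refine h1.trans_eq ?_
  congr 1
  rw [Real.sqrt_eq_rpow, ← Real.rpow_natCast h (2 * p + 1), ← Real.rpow_mul hh.le,
    ← Real.rpow_sub hh]
  congr 1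
  rw [hκ]
  push_cast
  field_simp

/-- Two further powers of `d` buy a weight that is summable over the modes. -/
theorem exists_pow_mul_le_sqrt_mul_inv (s : ℕ) (K₀ : ℝ) (Km : ℕ → ℝ) (k : ℕ) :
    ∃ K : ℝ, 0 ≤ K ∧ ∀ N d A : ℝ, 1 ≤ N → 0 ≤ d → 0 ≤ A → A ≤ K₀ →
      (∀ m, d ^ m * A ≤ Km m * N ^ s) → d ^ k * A ≤ K * √N * (1 + d ^ 2)⁻¹ := by
  obtain ⟨K₁, h₁, H₁⟩ := exists_pow_mul_le_sqrt s K₀ Km k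
  obtain ⟨K₂, h₂, H₂⟩ := exists_pow_mul_le_sqrt s K₀ Km (k + 2)
  refine ⟨K₁ + K₂, by positivity, fun N d A hN hd hA hA0 hm => ?_⟩
  rw [le_mul_inv_iff₀ (by positivity)]
  calc d ^ k * A * (1 + d ^ 2) = d ^ k * A + d ^ (k + 2) * A := by ring
    _ ≤ K₁ * √N + K₂ * √N :=
      add_le_add (H₁ N d A hN hd hA hA0 hm) (H₂ N d A hN hd hA hA0 hm)
    _ = _ := by ring

/-- Bounds for the grid modes of the initial data, summable over the modes. -/
theorem exists_initial_modes_le (p : ℕ) {L : ℝ} (hL : 0 < L) (x₀ : ℝ) {u : ℝ → ℂ}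
    (hu : ContDiff ℝ ∞ u) (hper : Function.Periodic u L) (r s : ℕ) (B : ℝ)
    {Q : ℕ → (ℝ → ℂ) → ℂ[X]}
    (hQ : ∀ N : ℕ, 1 ≤ N → IsCellProjection p r (B * (N : ℝ) ^ s) (Q N)) {C₀ : ℝ}
    (hmom : ∀ N : ℕ, 1 ≤ N → ∀ (j : ℤ) (k : ℕ), k ≤ p →
      ‖∫ ξ in (-1 : ℝ)..1, ((Q N (onCell u x₀ (L / N) j)).eval (ξ : ℂ) - onCell u x₀ (L / N) j ξ)
        * (legendre k).eval (ξ : ℂ)‖ ≤ C₀ * (L / N) ^ (2 * p + 1 - k)) :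
    ∃ K : ℝ, 0 ≤ K ∧ ∀ (N : ℕ) [NeZero N] (n : ZMod N),
      |(n.valMinAbs : ℝ)| ^ (2 * p + 2) * ‖modeCoeff (cellData p (Q N) u x₀ (L / N)) n‖ ≤
        K * √N * (1 + |(n.valMinAbs : ℝ)| ^ 2)⁻¹ ∧
      |(n.valMinAbs : ℝ)| * ‖modeCoeff (cellData p (Q N) u x₀ (L / N)) n‖ ≤
        K * √N * (1 + |(n.valMinAbs : ℝ)| ^ 2)⁻¹ ∧
      ∃ c : ℂ, N * ‖modeCoeff (cellData p (Q N) u x₀ (L / N)) n - c • Cell.one p‖ ≤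
        K * √N * (1 + |(n.valMinAbs : ℝ)| ^ 2)⁻¹ := by
  obtain ⟨b, hb0, hb⟩ := exists_bound_iteratedDeriv hu hL.ne' hper 0
  obtain ⟨Ki, hKi0, hKi⟩ := exists_norm_cellData_sub_eval_le p hu hL hper x₀ C₀
  choose Kd hKd0 hKd using exists_pow_mul_norm_modeCoeff_le p r hu hL hper x₀
  obtain ⟨K₁, h₁, H₁⟩ := exists_pow_mul_le_sqrt_mul_inv s (Ki * L + b * ‖Cell.one p‖)
    (fun m => Kd m * |B|) (2 * p + 2)
  obtain ⟨K₂, h₂, H₂⟩ := exists_pow_mul_le_sqrt_mul_inv s (Ki * L + b * ‖Cell.one p‖)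
    (fun m => Kd m * |B|) 1
  -- Used for `N` times the modes of the data minus their left end-point values: these data are
  -- O(h), so the product is bounded by `Ki * L`, while the factor `N` raises the growth exponent to
  -- `s + 1`.
  obtain ⟨K₃, h₃, H₃⟩ := exists_pow_mul_le_sqrt_mul_inv (s + 1) (Ki * L)
    (fun m => Kd m * (|B| + 1)) 0
  refine ⟨K₁ + K₂ + K₃, by positivity, fun N _ n => ?_⟩
  have hN : 1 ≤ N := NeZero.one_le
  have hN1 : (1 : ℝ) ≤ N := by exact_mod_cast hN
  have hN0 : (0 : ℝ) < N := by linarith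
  have hh0 : 0 < L / N := by positivity
  have hhL : L / N ≤ L := div_le_self hL.le hN1
  have hQN := (hQ N hN).mono
    (mul_le_mul_of_nonneg_right (le_abs_self B) (by positivity : (0 : ℝ) ≤ (N : ℝ) ^ s))
  have hQN' := hQN.sub_eval
  set d := |(n.valMinAbs : ℝ)| with hd
  have hd0 : 0 ≤ d := abs_nonneg _
  set A := modeCoeff (cellData p (Q N) u x₀ (L / N)) n with hA
  set Q' : (ℝ → ℂ) → ℂ[X] := fun v => Q N v - C (v (-1)) with hQ'
  have hval : ∀ j : ℤ, ‖onCell u x₀ (L / N) j (-1)‖ ≤ b := fun j => by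
    simpa [onCell] using hb 0 le_rfl (x₀ + j * (L / N))
  have hY : ∀ j : ℤ, ‖cellData p Q' u x₀ (L / N) j‖ ≤ Ki * (L / N) := fun j =>
    hKi _ hh0 hhL j _ ((hQ N hN).natDegree_le _ (contDiff_onCell hu _ _ _)) (hmom N hN j)
  have hsplit : ∀ j : ℤ, cellData p (Q N) u x₀ (L / N) j =
      cellData p Q' u x₀ (L / N) j + onCell u x₀ (L / N) j (-1) • Cell.one p := by
    intro j
    ext1
    have hc := contDiff_onCell hu x₀ (L / N) j
    rw [Submodule.coe_add, Submodule.coe_smul, cellData, cellData,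
      coe_toCell (hQN.natDegree_le _ hc), coe_toCell (hQN'.natDegree_le _ hc), Cell.one, hQ',
      smul_C, smul_eq_mul, mul_one, sub_add_cancel]
  have hX : ∀ j : ℤ, ‖cellData p (Q N) u x₀ (L / N) j‖ ≤ Ki * L + b * ‖Cell.one p‖ := by
    intro j
    rw [hsplit j]
    refine (norm_add_le _ _).trans (add_le_add ((hY j).trans ?_) ?_)
    · gcongr
    · rw [norm_smul]
      gcongr
      exact hval j
  have hA0 : ‖A‖ ≤ Ki * L + b * ‖Cell.one p‖ := norm_modeCoeff_le hX n
  have hAm : ∀ m, d ^ m * ‖A‖ ≤ Kd m * |B| * (N : ℝ) ^ s := fun m => by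
    rw [mul_assoc]
    exact hKd m N _ (Q N) (by positivity) hQN n
  have hw : 0 ≤ √N * (1 + d ^ 2)⁻¹ := by positivity
  -- The approximating constant is the grid mode of the left end-point values.
  refine ⟨?_, ?_, modeCoeff (fun j => onCell u x₀ (L / N) j (-1)) n, ?_⟩
  · refine (H₁ N d _ hN1 hd0 (norm_nonneg _) hA0 hAm).trans ?_
    rw [mul_assoc, mul_assoc]
    gcongr
    linarith
  · have h := H₂ N d _ hN1 hd0 (norm_nonneg _) hA0 hAm
    rw [pow_one] at h
    refine h.trans ?_
    rw [mul_assoc, mul_assoc]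
    gcongr
    linarith
  · have e : A - modeCoeff (fun j => onCell u x₀ (L / N) j (-1)) n • Cell.one p =
        modeCoeff (cellData p Q' u x₀ (L / N)) n := by
      rw [← modeCoeff_smul_const, hA, ← modeCoeff_sub]
      congr 1
      funext j
      rw [hsplit j, add_sub_cancel_right]
    rw [e]
    have hB0 : N * ‖modeCoeff (cellData p Q' u x₀ (L / N)) n‖ ≤ Ki * L := by
      calc _ ≤ N * (Ki * (L / N)) := by
            gcongr
            exact norm_modeCoeff_le hY n
        _ = _ := by field_simp
    have hBm : ∀ m, d ^ m * (N * ‖modeCoeff (cellData p Q' u x₀ (L / N)) n‖) ≤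
        Kd m * (|B| + 1) * (N : ℝ) ^ (s + 1) := by
      intro m
      have h1 := hKd m N _ Q' (by positivity) hQN' n
      have h2 : |B| * (N : ℝ) ^ s + 1 ≤ (|B| + 1) * (N : ℝ) ^ s := by
        have : (1 : ℝ) ≤ (N : ℝ) ^ s := one_le_pow₀ hN1
        linarith
      have h3 := hKd0 m
      calc _ = N * (d ^ m * ‖modeCoeff (cellData p Q' u x₀ (L / N)) n‖) := by ring
        _ ≤ N * (Kd m * ((|B| + 1) * (N : ℝ) ^ s)) :=
          mul_le_mul_of_nonneg_left (h1.trans (mul_le_mul_of_nonneg_left h2 h3)) hN0.le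
        _ = _ := by ring
    have h := H₃ N d _ hN1 hd0 (by positivity) hB0 hBm
    rw [pow_zero, one_mul] at h
    refine h.trans ?_
    rw [mul_assoc, mul_assoc]
    gcongr
    linarith

/-- The bound for one grid mode. -/
theorem mode_term_le {p : ℕ} {L N d K₀ K₁ E E₀ X Y T : ℝ} (hN : 1 ≤ N) (hL : 0 < L)
    (hK₀ : 0 ≤ K₀) (hK₁ : 0 ≤ K₁) (hE0 : 0 ≤ E)
    (hE : E ≤ E₀ * ((L / N) ^ (2 * p + 1) / √(L / N)))
    (h1 : d ^ (2 * p + 2) * X ≤ K₁ * √N * (1 + d ^ 2)⁻¹)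
    (h2 : d * X ≤ K₁ * √N * (1 + d ^ 2)⁻¹) (h3 : N * Y ≤ K₁ * √N * (1 + d ^ 2)⁻¹)
    (hT : T ≤ K₀ * ((2 * Real.pi * d / N) ^ (2 * p + 2) * X) +
      K₀ * (E * (Y + 2 * Real.pi * d / N * X))) :
    T ≤ (K₀ * K₁ * ((2 * Real.pi) ^ (2 * p + 2) / L ^ (2 * p + 1)) +
      K₀ * K₁ * (E₀ * (1 + 2 * Real.pi) / √L)) * (L / N) ^ (2 * p + 1) * (1 + d ^ 2)⁻¹ := by
  have hN0 : 0 < N := by linarith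
  have hpi := Real.pi_pos
  set W := (1 + d ^ 2)⁻¹ with hW
  have hW0 : 0 ≤ W := by positivity
  have hs : √N * √N = N := Real.mul_self_sqrt hN0.le
  have hs1 : 1 ≤ √N := Real.one_le_sqrt.2 hN
  -- The residual has order `2 * p + 2`, one more than needed, so a whole factor `N` may be spent
  -- here.
  have hsN : √N ≤ N := by nlinarith
  have a1 : (2 * Real.pi * d / N) ^ (2 * p + 2) * X ≤
      K₁ * ((2 * Real.pi) ^ (2 * p + 2) / L ^ (2 * p + 1)) * (L / N) ^ (2 * p + 1) * W := by
    calc _ = (2 * Real.pi / N) ^ (2 * p + 2) * (d ^ (2 * p + 2) * X) := by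
          rw [show 2 * Real.pi * d / N = 2 * Real.pi / N * d by ring, mul_pow]; ring
      _ ≤ (2 * Real.pi / N) ^ (2 * p + 2) * (K₁ * N * W) :=
          mul_le_mul_of_nonneg_left (h1.trans (by gcongr)) (by positivity)
      _ = _ := by
          rw [div_pow, div_pow]
          field_simp
          ring
  -- This gain of `1 / √N` compensates the factor `1 / √h` lost in `hE`.
  have a2 : Y + 2 * Real.pi * d / N * X ≤ (1 + 2 * Real.pi) * K₁ * W / √N := by
    have e : Y + 2 * Real.pi * d / N * X = (N * Y + 2 * Real.pi * (d * X)) / N := by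
      field_simp
    rw [e, div_le_div_iff₀ hN0 (by positivity)]
    calc _ ≤ (K₁ * √N * W + 2 * Real.pi * (K₁ * √N * W)) * √N := by gcongr
      _ = (1 + 2 * Real.pi) * K₁ * W * (√N * √N) := by ring
      _ = _ := by rw [hs]
  have a3 : E * (Y + 2 * Real.pi * d / N * X) ≤
      K₁ * (E₀ * (1 + 2 * Real.pi) / √L) * (L / N) ^ (2 * p + 1) * W := by
    calc _ ≤ E₀ * ((L / N) ^ (2 * p + 1) / √(L / N)) * ((1 + 2 * Real.pi) * K₁ * W / √N) :=
          (mul_le_mul_of_nonneg_left a2 hE0).trans (mul_le_mul_of_nonneg_right hE (by positivity))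
      _ = _ := by
          rw [Real.sqrt_div hL.le]
          have : √L ≠ 0 := (Real.sqrt_pos.2 hL).ne'
          have : √N ≠ 0 := by positivity
          field_simp
  calc T ≤ K₀ * (K₁ * ((2 * Real.pi) ^ (2 * p + 2) / L ^ (2 * p + 1)) * (L / N) ^ (2 * p + 1) * W)
        + K₀ * (K₁ * (E₀ * (1 + 2 * Real.pi) / √L) * (L / N) ^ (2 * p + 1) * W) :=
        hT.trans (by gcongr)
    _ = _ := by ring

end DGAdvection
end

/-! ### Assembly of the advection estimate -/

theorem corollary2 (p : ℕ) :
    (∀ z : ℂ, DGAdvection.IsNonphysicalRoot p z → 0 < z.re) ∧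
    ∀ (μ : ℝ), 0 < μ → (∀ z : ℂ, DGAdvection.IsNonphysicalRoot p z → μ ≤ z.re) →
    ∀ (a L x₀ : ℝ), 0 < a → 0 < L →
    -- a smooth periodic initial profile
    ∀ (u₀ : ℝ → ℂ), ContDiff ℝ ∞ u₀ → Function.Periodic u₀ L →
    -- for each `N ≥ 1`, one linear projection, used on every cell of the uniform mesh with `N`
    -- cells; its norm may grow polynomially in `N`
    ∀ (r s : ℕ) (B : ℝ) (Q : ℕ → (ℝ → ℂ) → Polynomial ℂ),
    (∀ N : ℕ, 1 ≤ N → DGAdvection.IsCellProjection p r (B * (N : ℝ) ^ s) (Q N)) →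
    -- the numerical solutions, of mesh size `h = L / N`
    ∀ (U : ℕ → ℤ → ℝ → Polynomial ℂ),
    (∀ N : ℕ, 1 ≤ N → DGAdvection.IsDGSolution p a (L / N) N (U N)) →
    (∀ N : ℕ, 1 ≤ N → ∀ j : ℤ, U N j 0 = Q N (DGAdvection.onCell u₀ x₀ (L / N) j)) →
    -- the moments of the initial error are of order `h ^ (2p+1-k)`
    (∃ C₀ : ℝ, ∀ N : ℕ, 1 ≤ N → ∀ (j : ℤ) (k : ℕ), k ≤ p →
      ‖∫ ξ in (-1 : ℝ)..1, ((U N j 0).eval (ξ : ℂ) - DGAdvection.onCell u₀ x₀ (L / N) j ξ)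
        * (DGAdvection.legendre k).eval (ξ : ℂ)‖ ≤ C₀ * (L / N) ^ (2 * p + 1 - k)) →
    -- once the non-physical modes are damped to order `h ^ (2p+1)`, advection has that accuracy
    ∀ M : ℝ, ∃ K : ℝ, ∀ N : ℕ, 1 ≤ N → ∀ t : ℝ, 0 ≤ t →
      Real.exp (-(a * μ * t / (L / N))) ≤ M * (L / N) ^ (2 * p + 1) →
      ∀ j : ℤ, ∀ ξ ∈ Set.Icc (-1 : ℝ) 1,
        ‖(U N (j + 1) (t + L / N / a)).eval (ξ : ℂ) - (U N j t).eval (ξ : ℂ)‖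
          ≤ K * (L / N) ^ (2 * p + 1) := by
  refine ⟨fun z hz => hz.re_pos, fun μ hμ0 hμ a L x₀ ha hL u₀ hu hper r s B Q hQ U hU hinit
    ⟨C₀, hmom⟩ M => ?_⟩
  -- A rate strictly below `μ` allows for multiple roots and for uniformity in θ; this one costs
  -- only half a power of `h`.
  obtain ⟨ν, hν⟩ : ∃ ν : ℝ, ν = μ * (1 - 1 / (2 * (2 * p + 1))) := ⟨_, rfl⟩
  have hp : (0 : ℝ) ≤ p := p.cast_nonneg
  have hfrac : 0 < 1 / (2 * (2 * p + 1) : ℝ) ∧ 1 / (2 * (2 * p + 1) : ℝ) < 1 :=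
    ⟨by positivity, by rw [div_lt_one (by positivity)]; linarith⟩
  have hν0 : 0 < ν := by rw [hν]; exact mul_pos hμ0 (by linarith [hfrac.2])
  have hνμ : ν < μ := by rw [hν]; nlinarith [hfrac.1]
  obtain ⟨K₀, hK₀, hmode⟩ := DGAdvection.exists_norm_flow_upwind_shift_le p hν0 hνμ hμ
  obtain ⟨K₁, hK₁, hdata⟩ := DGAdvection.exists_initial_modes_le p hL x₀ hu hper r s B hQ
    (C₀ := C₀) (fun N hN j k hk => by rw [← hinit N hN j]; exact hmom N hN j k hk)
  obtain ⟨S, hS0, hS⟩ := DGAdvection.exists_sum_valMinAbs_le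
  obtain ⟨ke, hke0, hke⟩ := DGAdvection.Cell.exists_eval_le p
  obtain ⟨E₀, hE₀⟩ : ∃ E₀ : ℝ, E₀ = M ^ (1 - 1 / (2 * (2 * p + 1)) : ℝ) := ⟨_, rfl⟩
  obtain ⟨K₂, hK₂⟩ : ∃ K₂ : ℝ, K₂ = K₀ * K₁ * ((2 * Real.pi) ^ (2 * p + 2) / L ^ (2 * p + 1)) +
      K₀ * K₁ * (E₀ * (1 + 2 * Real.pi) / √L) := ⟨_, rfl⟩
  refine ⟨ke * (K₂ * S), fun N hN t ht hexp j ξ hξ => ?_⟩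
  have : NeZero N := ⟨by omega⟩
  have hN1 : (1 : ℝ) ≤ N := by exact_mod_cast hN
  have hh : 0 < L / N := by positivity
  -- Positivity of `M` is forced as soon as some time satisfies the damping condition.
  have hM0 : 0 < M := pos_of_mul_pos_left ((Real.exp_pos _).trans_le hexp) (by positivity)
  have hE₀0 : 0 ≤ E₀ := by rw [hE₀]; positivity
  have hK₂0 : 0 ≤ K₂ := by rw [hK₂]; positivity
  have hτ : 0 ≤ a / (L / N) * t := by positivity
  have hE : Real.exp (-(ν * (a / (L / N) * t))) ≤
      E₀ * ((L / N) ^ (2 * p + 1) / √(L / N)) := by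
    rw [hν, hE₀]
    refine DGAdvection.exp_neg_mul_le_of_exp_le hh ?_
    rwa [show μ * (a / (L / N) * t) = a * μ * t / (L / N) by ring]
  have hdeg1 := (hU N hN).natDegree_le (j + 1) (t + L / N / a) (by positivity)
  have hdeg2 := (hU N hN).natDegree_le j t ht
  have hfin : ‖DGAdvection.toCell p (U N (j + 1) (t + L / N / a)) -
      DGAdvection.toCell p (U N j t)‖ ≤ K₂ * S * (L / N) ^ (2 * p + 1) := by
    refine ((hU N hN).norm_shift_le ha hh j ht).trans ?_
    have h0 : (fun j => DGAdvection.toCell p (U N j 0)) =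
        DGAdvection.cellData p (Q N) u₀ x₀ (L / N) := by
      funext j
      rw [hinit N hN j]
      rfl
    rw [h0]
    calc _ ≤ ∑ n : ZMod N, K₂ * (L / N) ^ (2 * p + 1) * (1 + |(n.valMinAbs : ℝ)| ^ 2)⁻¹ := by
          refine Finset.sum_le_sum fun n _ => ?_
          obtain ⟨h1, h2, c, h3⟩ := hdata N n
          have hm := hmode (DGAdvection.modeAngle n) _ hτ
            (DGAdvection.modeCoeff (DGAdvection.cellData p (Q N) u₀ x₀ (L / N)) n) c
          rw [DGAdvection.abs_modeAngle] at hm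
          rw [hK₂]
          exact DGAdvection.mode_term_le hN1 hL hK₀ hK₁ (Real.exp_pos _).le hE h1 h2 h3 hm
      _ = K₂ * (L / N) ^ (2 * p + 1) * ∑ n : ZMod N, (1 + |(n.valMinAbs : ℝ)| ^ 2)⁻¹ := by
          rw [Finset.mul_sum]
      _ ≤ K₂ * (L / N) ^ (2 * p + 1) * S := by
          gcongr
          exact hS N
      _ = _ := by ring
  have hev := hke (DGAdvection.toCell p (U N (j + 1) (t + L / N / a)) -
      DGAdvection.toCell p (U N j t)) ξ hξ
  rw [Submodule.coe_sub, DGAdvection.coe_toCell hdeg1, DGAdvection.coe_toCell hdeg2,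
    Polynomial.eval_sub] at hev
  calc _ ≤ ke * (K₂ * S * (L / N) ^ (2 * p + 1)) := hev.trans (by gcongr)
    _ = _ := by ring
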